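/- **Setting.** Let $n\ge 2$, write points of $\mathbb R^n$ as $z=(x,y)$ with $x\in\mathbb R^{n-1}$, $y\in\mathbb R$. Let $(\Omega,\mathcal F,P)$ be a probability space and let $w:\mathbb R\times\Omega\to\mathbb R$ be *mild white noise*: (i) there is $M>0$ with $w(\cdot,\omega)\in C^1(\mathbb R)$ and $|w|,|w'|\le M$ almost surely; (ii) $E[w(y)]=0$ for all $y$; (iii) $w$ is stationary and, for some $p>3/2$, $\int_0^\infty\varrho(y)^{1/p}\,dy<\infty$, where $$\varrho(y)=\sup_{y_1\le y_2}\ \sup\Big\{\tfrac{|P(A\cap B)-P(A)P(B)|}{P(B)}: A\in\sigma(w(s):s\ge y_2+y),\ B\in\sigma(w(s):y_1\le s\le y_2)\Big\}$$ (null events $B$ contributing $0$); and, as a normalization, $2\int_0^\infty E[w(0)w(\xi)]\,d\xi=1$. Let $u(x,y,t)=(u_\perp(x,y,t),\,u_\parallel(x,t)\,w(y))$ with $u_\perp\in C^2(\mathbb R^n\times[0,\infty))^{n-1}$ and $u_\parallel\in C^2(\mathbb R^{n-1}\times[0,\infty))$. Let $\alpha\in[1,\infty]$ (with $\epsilon^\infty=0$),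 and let $\epsilon>0$ satisfy $\epsilon|u|\le 1/100$ on $\mathbb R^n\times[0,\infty)$. The *G-equation* with datum $G_0$ is $$G_t+\epsilon\,u(x,y,\epsilon^\alpha t)\cdot\nabla G+|\nabla G|=0\ \text{ in }\mathbb R^n\times(0,\infty),\qquad G=G_0\ \text{ on }\mathbb R^n\times\{0\}.\tag{1}$$ A solution is a locally bounded, possibly discontinuous, viscosity solution on $\mathbb R^n\times[0,\infty)$: the upper (lower) semicontinuous envelope of $G$ is a viscosity subsolution (supersolution) for $t>0$, $G(\cdot,0)=G_0$, and $G^*(\cdot,0)\le (G_0)^*$, $G_*(\cdot,0)\ge (G_0)_*$. A function $G_0\in L^\infty_{\rm loc}(\mathbb R^n)$ is *front-like* if there are locally Lipschitz $\underline G,\overline G:\mathbb R\to\mathbb R$ that are $C^1$ with positive derivative on $\mathbb R\setminus\{0\}$, vanish at $0$, and satisfy $\underline G(y)\le G_0(x,y)\le\overline G(y)$ for all $(x,y)$. A *perturbed traveling wave* is a function $G^\epsilon_{\rm ptw}(x,y,t)=y-t+\epsilon^{2/3}\chi^\epsilon(x,\epsilon^{2/3}y,\epsilon^{2/3}t)$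 that solves the G-equation, i.e. (1) with datum $G^\epsilon_{\rm ptw}(\cdot,\cdot,0)$, and whose initial datum $G^\epsilon_{\rm ptw}(\cdot,\cdot,0)$ is front-like. **Proposition.** For almost every $\omega\in\Omega$, and for all $\epsilon$, $\alpha$ as above, the following hold. (a) Let $\rho^\epsilon$ be a globally Lipschitz solution of the planar metric problem $\epsilon u(\cdot,0)\cdot\nabla\rho^\epsilon+|\nabla\rho^\epsilon|=1$ with $\rho^\epsilon=0$ on $\{y=0\}$ and, uniformly in $x$, $\liminf_{y\to\infty}\rho^\epsilon\ge0$ and $\limsup_{y\to-\infty}\rho^\epsilon\le0$. The equation is understood in the viscosity sense for $\rho^\epsilon$ in $\{y>0\}$ and, symmetrically, in the viscosity sense for $-\rho^\epsilon$, i.e. as $-\epsilon u(\cdot,0)\cdot\nabla(-\rho^\epsilon)+|\nabla(-\rho^\epsilon)|=1$, in $\{y<0\}$. Then every function of the form $y-t+\epsilon^{2/3}\chi^\epsilon(x,\epsilon^{2/3}y,\epsilon^{2/3}t)$ that solves (1) with datum $\rho^\epsilon$ is a perturbed traveling wave. (b) Let $G^\epsilon_{\rm ptw}$ be a perturbed traveling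 wave, and let $G^\epsilon$ solve (1) with a front-like datum $G_0$. Then, for every $t>0$, $$\{(x,y): G^\epsilon(x,y,t)=0\}=\{(x,y):G^\epsilon_{\rm ptw}(x,y,t)=0\}.$$ Moreover, $\{G^\epsilon\le0\}=\{G^\epsilon_{\rm ptw}\le 0\}$ as subsets of $\mathbb R^n\times[0,\infty)$. -/

import Mathlib

open MeasureTheory Filter Topology Set
open scoped ENNReal RealInnerProductSpace

noncomputable section

namespace GEq

/-- `ℝ^d` with the Euclidean norm (the transverse variable `x`). -/
abbrev Tr (d : ℕ) : Type := EuclideanSpace ℝ (Fin d)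

/-- `ℝ^{d+1} = ℝ^d × ℝ` with the Euclidean norm; points are `(x, y)`, `x = z.fst`, `y = z.snd`. -/
abbrev Pt (d : ℕ) : Type := WithLp 2 (Tr d × ℝ)

/-! ### Mild white noise -/

section Noise

variable {Ω : Type*} [MeasurableSpace Ω]

/-- The σ-algebra generated by `w y`, `y ∈ I`. -/
@[reducible] def sigmaOn (w : ℝ → Ω → ℝ) (I : Set ℝ) : MeasurableSpace Ω :=
  ⨆ y ∈ I, MeasurableSpace.comap (w y) inferInstance

/-- The strong mixing rate of `w` (with the convention that null events `B` contribute `0`). -/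
def mixingRate (P : Measure Ω) (w : ℝ → Ω → ℝ) (y : ℝ) : ℝ≥0∞ :=
  ⨆ (y₁ : ℝ) (y₂ : ℝ) (_ : y₁ ≤ y₂) (A : Set Ω) (_ : MeasurableSet[sigmaOn w (Ici (y₂ + y))] A)
    (B : Set Ω) (_ : MeasurableSet[sigmaOn w (Icc y₁ y₂)] B),
    ENNReal.ofReal |P.real (A ∩ B) - P.real A * P.real B| / P B

/-- Mild approximation of white noise, normalized so that the limiting Brownian motion is
standard. -/
structure IsMildWhiteNoise (P : Measure Ω) (w : ℝ → Ω → ℝ) : Prop where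
  measurable : ∀ y, Measurable (w y)
  c1_bound : ∃ M : ℝ, 0 < M ∧ ∀ᵐ ω ∂P, ContDiff ℝ 1 (fun y => w y ω) ∧
    ∀ y, |w y ω| ≤ M ∧ |deriv (fun y' => w y' ω) y| ≤ M
  mean_zero : ∀ y, ∫ ω, w y ω ∂P = 0
  stationary : ∀ h : ℝ, P.map (fun ω y => w (y + h) ω) = P.map (fun ω y => w y ω)
  mixing : ∃ p : ℝ, 3 / 2 < p ∧ ∫⁻ y in Ioi (0 : ℝ), mixingRate P w y ^ (1 / p) < ∞
  normalized : 2 * ∫ ξ in Ioi (0 : ℝ), (∫ ω, w 0 ω * w ξ ω ∂P) = 1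

end Noise

/-! ### The advection -/

/-- `u(x, y, t) = (u_⊥(x, y, t), u_∥(x, t) v(y))`, where `v` is one realization of the noise. -/
def advection {d : ℕ} (uperp : Tr d × ℝ × ℝ → Tr d) (upar : Tr d × ℝ → ℝ) (v : ℝ → ℝ)
    (z : Pt d) (t : ℝ) : Pt d :=
  WithLp.toLp 2 (uperp (z.fst, z.snd, t), upar (z.fst, t) * v z.snd)

/-- `ε ^ α` for `α ∈ [0, ∞]`, with the convention `ε ^ ∞ = 0`. -/
def epsPow (ε : ℝ) (α : ℝ≥0∞) : ℝ := if α = ∞ then 0 else ε ^ α.toReal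

/-! ### Front-like initial data -/

/-- Admissible one-dimensional barriers: locally Lipschitz on `ℝ`, `C¹` with positive derivative
away from `0`, and vanishing at `0`. -/
structure IsBarrier (g : ℝ → ℝ) : Prop where
  locallyLipschitz : LocallyLipschitz g
  contDiffOn : ContDiffOn ℝ 1 g {0}ᶜ
  deriv_pos : ∀ y, y ≠ 0 → 0 < deriv g y
  zero : g 0 = 0

structure IsFrontLike {d : ℕ} (G₀ : Pt d → ℝ) : Prop where
  locallyBounded : ∀ K : Set (Pt d), IsCompact K → MemLp G₀ ∞ (volume.restrict K)
  barriers : ∃ glow gup : ℝ → ℝ, IsBarrier glow ∧ IsBarrier gup ∧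
    ∀ z : Pt d, glow z.snd ≤ G₀ z ∧ G₀ z ≤ gup z.snd

/-! ### Viscosity solutions -/

/-- Upper semicontinuous envelope of `f`, as a function on the set `S`. -/
def upperEnv {X : Type*} [TopologicalSpace X] (S : Set X) (f : X → ℝ) (p : X) : ℝ :=
  limsup f (𝓝[S] p)

/-- Lower semicontinuous envelope of `f`, as a function on the set `S`. -/
def lowerEnv {X : Type*} [TopologicalSpace X] (S : Set X) (f : X → ℝ) (p : X) : ℝ :=
  liminf f (𝓝[S] p)

/-- The closed space-time half space `ℝ^{d+1} × [0, ∞)`. -/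
def spaceTime (d : ℕ) : Set (Pt d × ℝ) := {p | 0 ≤ p.2}

/-- The expression `φ_t + ε u(x, y, ε^α t) · ∇φ + |∇φ|` at the space-time point `p`. -/
def gOperator {d : ℕ} (ε : ℝ) (α : ℝ≥0∞) (u : Pt d → ℝ → Pt d) (φ : Pt d × ℝ → ℝ)
    (p : Pt d × ℝ) : ℝ :=
  deriv (fun s => φ (p.1, s)) p.2
    + ε * ⟪u p.1 (epsPow ε α * p.2), gradient (fun z => φ (z, p.2)) p.1⟫
    + ‖gradient (fun z => φ (z, p.2)) p.1‖

/-- `G` is a (possibly discontinuous) viscosity solution of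
`G_t + ε u(x, y, ε^α t) · ∇G + |∇G| = 0` in `ℝ^{d+1} × (0, ∞)` with `G = G₀` at `t = 0`:
`G` is locally bounded, its upper envelope is a subsolution, its lower envelope is a supersolution,
and the envelopes are controlled at `t = 0` by those of `G₀`.  Only the values of `G` for `t ≥ 0`
matter. -/
structure SolvesGEquation {d : ℕ} (ε : ℝ) (α : ℝ≥0∞) (u : Pt d → ℝ → Pt d)
    (G₀ : Pt d → ℝ) (G : Pt d × ℝ → ℝ) : Prop where
  locallyBounded : ∀ K ⊆ spaceTime d, IsCompact K → ∃ C : ℝ, ∀ p ∈ K, |G p| ≤ C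
  initial : ∀ z, G (z, 0) = G₀ z
  initial_upper : ∀ z, upperEnv (spaceTime d) G (z, 0) ≤ upperEnv univ G₀ z
  initial_lower : ∀ z, lowerEnv univ G₀ z ≤ lowerEnv (spaceTime d) G (z, 0)
  subsolution : ∀ p : Pt d × ℝ, 0 < p.2 → ∀ φ : Pt d × ℝ → ℝ, ContDiffAt ℝ 1 φ p →
    IsLocalMax (fun q => upperEnv (spaceTime d) G q - φ q) p → gOperator ε α u φ p ≤ 0
  supersolution : ∀ p : Pt d × ℝ, 0 < p.2 → ∀ φ : Pt d × ℝ → ℝ, ContDiffAt ℝ 1 φ p →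
    IsLocalMin (fun q => lowerEnv (spaceTime d) G q - φ q) p → 0 ≤ gOperator ε α u φ p

/-- The continuous function `ρ` is a viscosity solution of `ε b · ∇ρ + |∇ρ| = 1` in the open
set `U`. -/
structure SolvesEikonal {d : ℕ} (ε : ℝ) (b : Pt d → Pt d) (U : Set (Pt d)) (ρ : Pt d → ℝ) :
    Prop where
  continuousOn : ContinuousOn ρ U
  subsolution : ∀ z ∈ U, ∀ φ : Pt d → ℝ, ContDiffAt ℝ 1 φ z →
    IsLocalMax (fun z' => ρ z' - φ z') z → ε * ⟪b z, gradient φ z⟫ + ‖gradient φ z‖ ≤ 1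
  supersolution : ∀ z ∈ U, ∀ φ : Pt d → ℝ, ContDiffAt ℝ 1 φ z →
    IsLocalMin (fun z' => ρ z' - φ z') z → 1 ≤ ε * ⟪b z, gradient φ z⟫ + ‖gradient φ z‖

/-! ### Perturbed traveling waves -/

/-- The globally Lipschitz solution of the planar metric problem `ε b · ∇ρ + |∇ρ| = 1`,
`ρ = 0` on `{y = 0}`.  The two half spaces are treated symmetrically: `ρ` is a viscosity solution
above the plane, and below the plane `-ρ` is a viscosity solution of the problem with `b` replaced
by `-b`, which is the same equation for `ρ`. -/
structure IsPlanarMetricSolution {d : ℕ} (ε : ℝ) (b : Pt d → Pt d) (ρ : Pt d → ℝ) : Prop where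
  lipschitz : ∃ K, LipschitzWith K ρ
  zero : ∀ z : Pt d, z.snd = 0 → ρ z = 0
  above : SolvesEikonal ε b {z | 0 < z.snd} ρ
  below : SolvesEikonal ε (fun z => -b z) {z | z.snd < 0} (fun z => -ρ z)
  liminf_nonneg : ∀ δ > 0, ∃ R : ℝ, ∀ z : Pt d, R ≤ z.snd → -δ ≤ ρ z
  limsup_nonpos : ∀ δ > 0, ∃ R : ℝ, ∀ z : Pt d, z.snd ≤ -R → ρ z ≤ δ

/-- `y - t + ε^{2/3} χ(x, ε^{2/3} y, ε^{2/3} t)`. -/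
def ptw {d : ℕ} (ε : ℝ) (χ : Tr d × ℝ × ℝ → ℝ) (p : Pt d × ℝ) : ℝ :=
  p.1.snd - p.2 + ε ^ (2 / 3 : ℝ)
    * χ (p.1.fst, ε ^ (2 / 3 : ℝ) * p.1.snd, ε ^ (2 / 3 : ℝ) * p.2)

/-- `ptw ε χ` is a perturbed traveling wave: it solves the G-equation and starts from a front-like
datum. -/
structure IsPerturbedTravelingWave {d : ℕ} (ε : ℝ) (α : ℝ≥0∞) (u : Pt d → ℝ → Pt d)
    (χ : Tr d × ℝ × ℝ → ℝ) : Prop where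
  solves : SolvesGEquation ε α u (fun z => ptw ε χ (z, 0)) (ptw ε χ)
  frontLike : IsFrontLike (fun z : Pt d => ptw ε χ (z, 0))

/-- The front at time `t`, i.e. the zero level set. -/
def front {d : ℕ} (t : ℝ) (G : Pt d × ℝ → ℝ) : Set (Pt d) := {z | G (z, t) = 0}

/-- The zero sub-level set in `ℝ^{d+1} × [0, ∞)`. -/
def subLevel {d : ℕ} (G : Pt d × ℝ → ℝ) : Set (Pt d × ℝ) := {p | p ∈ spaceTime d ∧ G p ≤ 0}

end GEq

end

noncomputable section

namespace GEq

/-! ### Geometric invariance and the local comparison principle. -/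

section Comparison

variable {E : Type*} [NormedAddCommGroup E] [InnerProductSpace ℝ E]

section Gradient

variable [CompleteSpace E]

/-! The operator is positively homogeneous of degree one in the derivatives, so only level sets
matter: an increasing smooth relabeling of a sub- or supersolution is again one. Finite speed of
propagation makes comparison local: the value at `p` only depends on data in a ball, since drift
plus front speed is at most 2 (`comparison`, by doubling of variables with a penalty on a backward
cone).

For (b), let `A` be a subsolution and `U` a supersolution with front-like data. On the relevant
ball, `A ≤ δ * exp (N * U)` holds initially once `N` is large: where `y ≤ 0` the left side is
nonpositive, for small `y > 0` it is at most `δ`, and beyond that the datum of `U` is bounded below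
by a positive constant, so the exponential wins. Comparison gives `A p ≤ δ` wherever `U p ≤ 0`, and
`δ → 0` yields `A p ≤ 0`. The mirrored argument shows that `0 ≤ A p` forces `0 ≤ U p`. Applying both
to the envelopes of two solutions, in both orders, identifies zero sets and sublevel sets.

For (a), it remains to see that the planar metric profile is front-like. The Lipschitz bound gives
`|ρ| ≤ K |y|`; touching `ρ` from below by a shallow concave function of `y` gives `ρ ≥ y / 2` above
the plane, and reflection treats the lower half space. -/

lemma hasGradientAt_add {f g : E → ℝ} {f' g' x : E} (hf : HasGradientAt f f' x)
    (hg : HasGradientAt g g' x) : HasGradientAt (fun z => f z + g z) (f' + g') x := by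
  rw [hasGradientAt_iff_hasFDerivAt] at *
  rw [map_add]
  exact hf.add hg

lemma hasGradientAt_comp {f : E → ℝ} {f' x : E} {F : ℝ → ℝ} {c : ℝ}
    (hF : HasDerivAt F c (f x)) (hf : HasGradientAt f f' x) :
    HasGradientAt (fun z => F (f z)) (c • f') x := by
  rw [hasGradientAt_iff_hasFDerivAt] at *
  rw [map_smul]
  exact hF.comp_hasFDerivAt x hf

lemma hasGradientAt_norm_sub_sq (a x : E) :
    HasGradientAt (fun z => ‖z - a‖ ^ 2) ((2 : ℝ) • (x - a)) x := by
  rw [hasGradientAt_iff_hasFDerivAt]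
  have h := (hasStrictFDerivAt_norm_sq (x - a)).hasFDerivAt.comp x
    ((hasFDerivAt_id x).sub_const a)
  refine h.congr_fderiv ?_
  ext y
  simp [two_mul]

/-- The operator `φ_t + v · ∇φ + |∇φ|` at a space-time point. -/
def hamOp (v : E × ℝ → E) (φ : E × ℝ → ℝ) (p : E × ℝ) : ℝ :=
  deriv (fun s => φ (p.1, s)) p.2 + ⟪v p, gradient (fun z => φ (z, p.2)) p.1⟫
    + ‖gradient (fun z => φ (z, p.2)) p.1‖

/-- Viscosity subsolutions of `A_t + v · ∇A + |∇A| = 0` for positive times. -/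
def IsSub (v : E × ℝ → E) (A : E × ℝ → ℝ) : Prop :=
  ∀ p : E × ℝ, 0 < p.2 → ∀ φ : E × ℝ → ℝ, ContDiffAt ℝ 1 φ p →
    IsLocalMax (fun q => A q - φ q) p → hamOp v φ p ≤ 0

/-- Viscosity supersolutions of `B_t + v · ∇B + |∇B| = 0` for positive times. -/
def IsSuper (v : E × ℝ → E) (B : E × ℝ → ℝ) : Prop :=
  ∀ p : E × ℝ, 0 < p.2 → ∀ φ : E × ℝ → ℝ, ContDiffAt ℝ 1 φ p →
    IsLocalMin (fun q => B q - φ q) p → 0 ≤ hamOp v φ p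

lemma hamOp_eq {v : E × ℝ → E} {φ : E × ℝ → ℝ} {p : E × ℝ} {a : ℝ} {g : E}
    (ha : HasDerivAt (fun s => φ (p.1, s)) a p.2)
    (hg : HasGradientAt (fun z => φ (z, p.2)) g p.1) :
    hamOp v φ p = a + ⟪v p, g⟫ + ‖g‖ := by
  simp only [hamOp, ha.deriv, hg.gradient]

/-- The operator is geometric: it commutes with increasing relabelings of the level sets. -/
lemma hamOp_comp {v : E × ℝ → E} {φ : E × ℝ → ℝ} {p : E × ℝ} {F : ℝ → ℝ} {c : ℝ}
    (hφ : ContDiffAt ℝ 1 φ p) (hF : HasDerivAt F c (φ p)) (hc : 0 ≤ c) :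
    hamOp v (fun q => F (φ q)) p = c * hamOp v φ p := by
  have hd : DifferentiableAt ℝ φ (p.1, p.2) := hφ.differentiableAt one_ne_zero
  have h1 : DifferentiableAt ℝ (fun s => φ (p.1, s)) p.2 :=
    hd.comp p.2 (by fun_prop : DifferentiableAt ℝ (fun s : ℝ => (p.1, s)) p.2)
  have h2 : DifferentiableAt ℝ (fun z => φ (z, p.2)) p.1 :=
    hd.comp p.1 (by fun_prop : DifferentiableAt ℝ (fun z : E => (z, p.2)) p.1)
  rw [hamOp_eq h1.hasDerivAt h2.hasGradientAt,
    hamOp_eq (HasDerivAt.comp (h₂ := F) p.2 hF h1.hasDerivAt)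
      (hasGradientAt_comp (f := fun z => φ (z, p.2)) (F := F) hF h2.hasGradientAt),
    inner_smul_right, norm_smul, Real.norm_of_nonneg hc]
  ring

/-- The inverse relabeling, a logarithm, turns a test function for the exponential into one for `U`.
Since its derivative is positive, `hamOp_comp` transports the inequality back. -/
lemma IsSuper.const_mul_exp {v : E × ℝ → E} {U : E × ℝ → ℝ} (hU : IsSuper v U) {δ N : ℝ}
    (hδ : 0 < δ) (hN : 0 < N) : IsSuper v (fun q => δ * Real.exp (N * U q)) := by
  intro p hp φ hφ hmin
  set b := δ * Real.exp (N * U p) with hb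
  have hb0 : 0 < b := by positivity
  have hF : HasDerivAt (fun s => N⁻¹ * Real.log ((s - φ p + b) / δ)) (N⁻¹ * b⁻¹) (φ p) := by
    have h1 : HasDerivAt (fun s => (s - φ p + b) / δ) (1 / δ) (φ p) :=
      (((hasDerivAt_id (φ p)).sub_const (φ p)).add_const b).div_const δ
    have h2 := (h1.log (by simp; exact ⟨hb0.ne', hδ.ne'⟩)).const_mul N⁻¹
    refine h2.congr_deriv ?_
    simp only [sub_self, zero_add]
    field_simp
  have hc : 0 < N⁻¹ * b⁻¹ := by positivity
  have hψ : ContDiffAt ℝ 1 (fun q => N⁻¹ * Real.log ((φ q - φ p + b) / δ)) p := by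
    refine contDiffAt_const.mul (ContDiffAt.log ?_ ?_)
    · exact ((hφ.sub contDiffAt_const).add contDiffAt_const).div_const δ
    · simp; exact ⟨hb0.ne', hδ.ne'⟩
  have hpos : ∀ᶠ q in 𝓝 p, 0 < φ q - φ p + b := by
    have : ContinuousAt (fun q => φ q - φ p + b) p :=
      (hφ.continuousAt.sub continuousAt_const).add continuousAt_const
    exact this.eventually_const_lt (by simpa using hb0)
  have key := hU p hp _ hψ (by
    filter_upwards [hmin, hpos] with q hq hq0
    have h3 : φ q - φ p + b ≤ δ * Real.exp (N * U q) := by linarith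
    have h4 : Real.log ((φ q - φ p + b) / δ) ≤ N * U q := by
      rw [Real.log_le_iff_le_exp (by positivity), div_le_iff₀ hδ]
      linarith
    have h5 : Real.log ((φ p - φ p + b) / δ) = N * U p := by
      rw [sub_self, zero_add, hb, mul_div_cancel_left₀ _ hδ.ne', Real.log_exp]
    rw [h5, inv_mul_cancel_left₀ hN.ne', sub_self, sub_nonneg, inv_mul_le_iff₀ hN]
    exact h4)
  rw [hamOp_comp (F := fun s => N⁻¹ * Real.log ((s - φ p + b) / δ)) hφ hF hc.le] at key
  exact nonneg_of_mul_nonneg_right key hc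

lemma IsSub.neg_const_mul_exp {v : E × ℝ → E} {A : E × ℝ → ℝ} (hA : IsSub v A) {δ N : ℝ}
    (hδ : 0 < δ) (hN : 0 < N) : IsSub v (fun q => -(δ * Real.exp (-(N * A q)))) := by
  intro p hp φ hφ hmax
  set b := δ * Real.exp (-(N * A p)) with hb
  have hb0 : 0 < b := by positivity
  have hF : HasDerivAt (fun s => -(N⁻¹ * Real.log ((φ p - s + b) / δ))) (N⁻¹ * b⁻¹) (φ p) := by
    have h1 : HasDerivAt (fun s => (φ p - s + b) / δ) (-1 / δ) (φ p) :=
      (((hasDerivAt_id (φ p)).const_sub (φ p)).add_const b).div_const δ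
    have h2 := ((h1.log (by simp; exact ⟨hb0.ne', hδ.ne'⟩)).const_mul N⁻¹).neg
    refine h2.congr_deriv ?_
    simp only [sub_self, zero_add]
    field_simp
  have hc : 0 < N⁻¹ * b⁻¹ := by positivity
  have hψ : ContDiffAt ℝ 1 (fun q => -(N⁻¹ * Real.log ((φ p - φ q + b) / δ))) p := by
    refine (contDiffAt_const.mul (ContDiffAt.log ?_ ?_)).neg
    · exact ((contDiffAt_const.sub hφ).add contDiffAt_const).div_const δ
    · simp; exact ⟨hb0.ne', hδ.ne'⟩
  have hpos : ∀ᶠ q in 𝓝 p, 0 < φ p - φ q + b := by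
    have : ContinuousAt (fun q => φ p - φ q + b) p :=
      (continuousAt_const.sub hφ.continuousAt).add continuousAt_const
    exact this.eventually_const_lt (by simpa using hb0)
  have key := hA p hp _ hψ (by
    filter_upwards [hmax, hpos] with q hq hq0
    have h3 : φ p - φ q + b ≤ δ * Real.exp (-(N * A q)) := by linarith
    have h4 : Real.log ((φ p - φ q + b) / δ) ≤ -(N * A q) := by
      rw [Real.log_le_iff_le_exp (by positivity), div_le_iff₀ hδ]
      linarith
    have h5 : Real.log ((φ p - φ p + b) / δ) = -(N * A p) := by
      rw [sub_self, zero_add, hb, mul_div_cancel_left₀ _ hδ.ne', Real.log_exp]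
    have h6 : N⁻¹ * Real.log ((φ p - φ q + b) / δ) ≤ -A q := by
      rw [inv_mul_le_iff₀ hN]; linarith
    have h7 : N⁻¹ * Real.log ((φ p - φ p + b) / δ) = -A p := by
      rw [h5]; field_simp
    linarith)
  rw [hamOp_comp (F := fun s => -(N⁻¹ * Real.log ((φ p - s + b) / δ))) hφ hF hc.le] at key
  exact nonpos_of_mul_nonpos_right key hc

end Gradient

/-- A smooth replacement of the distance to `a`. -/
def smoothDist {E : Type*} [NormedAddCommGroup E] (a z : E) : ℝ := √(1 + ‖z - a‖ ^ 2)

lemma norm_sub_le_smoothDist {E : Type*} [NormedAddCommGroup E] (a z : E) : ‖z - a‖ ≤ smoothDist a z :=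
  Real.le_sqrt_of_sq_le (by linarith)

lemma one_le_smoothDist {E : Type*} [NormedAddCommGroup E] (a z : E) : 1 ≤ smoothDist a z :=
  Real.le_sqrt_of_sq_le (by nlinarith [sq_nonneg ‖z - a‖])

lemma contDiff_smoothDist (a : E) {n : WithTop ℕ∞} : ContDiff ℝ n (smoothDist a) := by
  unfold smoothDist
  refine ContDiff.sqrt ?_ fun z => by positivity
  exact contDiff_const.add ((contDiff_id.sub contDiff_const).norm_sq ℝ)

lemma hasGradientAt_smoothDist [CompleteSpace E] (a z : E) :
    HasGradientAt (smoothDist a) ((smoothDist a z)⁻¹ • (z - a)) z := by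
  have hpos : (0 : ℝ) < 1 + ‖z - a‖ ^ 2 := by positivity
  have h := hasGradientAt_comp (F := fun s => √(1 + s)) (f := fun z => ‖z - a‖ ^ 2)
    (((hasDerivAt_id (‖z - a‖ ^ 2)).const_add 1).sqrt hpos.ne') (hasGradientAt_norm_sub_sq a z)
  have he : (smoothDist a z)⁻¹ • (z - a)
      = (1 / (2 * √(1 + id (‖z - a‖ ^ 2)))) • (2 : ℝ) • (z - a) := by
    rw [smul_smul]
    congr 1
    simp only [smoothDist, id]
    field_simp
  rw [he]
  exact h

lemma norm_grad_smoothDist_le (a z : E) : ‖(smoothDist a z)⁻¹ • (z - a)‖ ≤ 1 := by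
  have h := one_le_smoothDist a z
  rw [norm_smul, norm_inv, Real.norm_of_nonneg (by linarith), inv_mul_le_iff₀ (by linarith)]
  simpa using norm_sub_le_smoothDist a z

/-- A penalization that grows rapidly outside a backward cone of speed `2`. -/
def conePenalty (κ σ N s₀ : ℝ) (z₀ : E) (q : E × ℝ) : ℝ :=
  κ * q.2 + σ * Real.exp (N * (smoothDist z₀ q.1 + 2 * q.2 - s₀))

lemma contDiff_conePenalty (κ σ N s₀ : ℝ) (z₀ : E) : ContDiff ℝ 1 (conePenalty κ σ N s₀ z₀) := by
  have h1 : ContDiff ℝ 1 (fun q : E × ℝ => smoothDist z₀ q.1) :=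
    (contDiff_smoothDist z₀).comp contDiff_fst
  have h2 : ContDiff ℝ 1 (fun q : E × ℝ => q.2) := contDiff_snd
  exact (contDiff_const.mul h2).add (contDiff_const.mul (Real.contDiff_exp.comp
    (contDiff_const.mul ((h1.add (contDiff_const.mul h2)).sub contDiff_const))))

/-- The two viscosity inequalities at a maximum point of the doubled functional. -/
lemma le_inner_of_doubling [CompleteSpace E] {v : E × ℝ → E} {A B : E × ℝ → ℝ}
    (hAs : IsSub v A) (hBs : IsSuper v B) {κ σ N s₀ m : ℝ} {z₀ z z' : E} {t t' : ℝ}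
    (hσ : 0 < σ) (hN : 0 < N) (ht : 0 < t) (ht' : 0 < t') (hv : ‖v (z, t)‖ ≤ 1)
    (hmax : IsLocalMax (fun q => A q - ((m / 2) * (‖q.1 - z'‖ ^ 2 + (q.2 - t') ^ 2)
      + conePenalty κ σ N s₀ z₀ q)) (z, t))
    (hmin : IsLocalMin (fun q => B q - (-(m / 2)) * (‖q.1 - z‖ ^ 2 + (q.2 - t) ^ 2)) (z', t')) :
    κ ≤ ⟪v (z', t') - v (z, t), m • (z - z')⟫ := by
  have ineqA := hAs (z, t) ht _ (by
    refine ContDiff.contDiffAt (ContDiff.add (contDiff_const.mul (ContDiff.add ?_ ?_))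
      (contDiff_conePenalty κ σ N s₀ z₀))
    · exact (contDiff_fst.sub contDiff_const).norm_sq ℝ
    · exact (contDiff_snd.sub contDiff_const).pow 2) hmax
  have ineqB := hBs (z', t') ht' _ (by
    refine ContDiff.contDiffAt (contDiff_const.mul (ContDiff.add ?_ ?_))
    · exact (contDiff_fst.sub contDiff_const).norm_sq ℝ
    · exact (contDiff_snd.sub contDiff_const).pow 2) hmin
  set e : ℝ := σ * Real.exp (N * (smoothDist z₀ z + 2 * t - s₀)) with he
  have he0 : 0 < e := by positivity
  set g : E := (e * N) • ((smoothDist z₀ z)⁻¹ • (z - z₀)) with hg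
  have hgn : ‖g‖ ≤ e * N := by
    rw [hg, norm_smul, Real.norm_of_nonneg (by positivity)]
    exact mul_le_of_le_one_right (by positivity) (norm_grad_smoothDist_le _ _)
  have hdt : ∀ c a b s : ℝ, HasDerivAt (fun s => c * (a + (s - b) ^ 2)) (c * (2 * (s - b))) s := by
    intro c a b s
    have := ((((hasDerivAt_id s).sub_const b).pow 2).const_add a).const_mul c
    refine this.congr_deriv ?_
    simp
  have hdz : ∀ (c a : ℝ) (b x : E),
      HasGradientAt (fun x => c * (‖x - b‖ ^ 2 + a)) ((2 * c) • (x - b)) x := by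
    intro c a b x
    have h1 : HasDerivAt (fun s => c * (s + a)) c (‖x - b‖ ^ 2) := by
      simpa using ((hasDerivAt_id (‖x - b‖ ^ 2)).add_const a).const_mul c
    have := hasGradientAt_comp (f := fun x => ‖x - b‖ ^ 2) h1 (hasGradientAt_norm_sub_sq b x)
    rwa [smul_smul, mul_comm c 2] at this
  have hKt : HasDerivAt (fun s => conePenalty κ σ N s₀ z₀ (z, s)) (κ + 2 * (e * N)) t := by
    have h1 : HasDerivAt (fun s : ℝ => N * (smoothDist z₀ z + 2 * s - s₀)) (N * 2) t := by
      simpa using ((((hasDerivAt_id t).const_mul 2).const_add (smoothDist z₀ z)).sub_const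
        s₀).const_mul N
    refine (((hasDerivAt_id t).const_mul κ).add (h1.exp.const_mul σ)).congr_deriv ?_
    rw [he]
    ring
  have hKz : HasGradientAt (fun x => conePenalty κ σ N s₀ z₀ (x, t)) g z := by
    have h1 : HasDerivAt (fun r : ℝ => κ * t + σ * Real.exp (N * (r + 2 * t - s₀))) (e * N)
        (smoothDist z₀ z) := by
      have h2 : HasDerivAt (fun r : ℝ => N * (r + 2 * t - s₀)) N (smoothDist z₀ z) := by
        simpa using (((hasDerivAt_id (smoothDist z₀ z)).add_const (2 * t)).sub_const s₀).const_mul N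
      refine ((h2.exp.const_mul σ).const_add (κ * t)).congr_deriv ?_
      rw [he]
      ring
    exact hasGradientAt_comp h1 (hasGradientAt_smoothDist z₀ z)
  rw [hamOp_eq (p := (z, t)) ((hdt (m / 2) (‖z - z'‖ ^ 2) t' t).add hKt)
    (hasGradientAt_add (hdz (m / 2) ((t - t') ^ 2) z' z) hKz)] at ineqA
  rw [hamOp_eq (p := (z', t')) (hdt (-(m / 2)) (‖z' - z‖ ^ 2) t t')
    (hdz (-(m / 2)) ((t' - t) ^ 2) z z')] at ineqB
  have hPB : (2 * (-(m / 2 : ℝ))) • (z' - z) = (m) • (z - z') := by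
    rw [← neg_sub z z', smul_neg, ← neg_smul]; congr 1; ring
  have hPA : (2 * (m / 2)) • (z - z') = (m) • (z - z') := by congr 1; ring
  rw [hPA] at ineqA
  rw [hPB] at ineqB
  set P : E := (m) • (z - z') with hP
  -- The exponential penalty contributes `2 * (e * N)` to the time derivative, while its gradient
  -- costs at most `2 * ‖g‖ ≤ 2 * (e * N)`. This is where cone speed 2 is needed; only `κ` survives.
  have hvg : -‖g‖ ≤ ⟪v (z, t), g⟫ := by
    have h1 := abs_real_inner_le_norm (v (z, t)) g
    have h2 := mul_le_of_le_one_left (norm_nonneg g) hv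
    linarith [neg_abs_le ⟪v (z, t), g⟫]
  have hPg : ‖P‖ - ‖g‖ ≤ ‖P + g‖ := by
    have := norm_sub_le (P + g) g
    rw [add_sub_cancel_right] at this
    linarith
  rw [inner_add_right] at ineqA
  rw [inner_sub_left]
  linarith

/-- Bounds the drift error in the doubling inequality by the doubling penalty itself, which vanishes
along the maximizers. -/
lemma inner_smul_sub_le_of_lipschitz {v : E × ℝ → E} {C : Set (E × ℝ)} {L : NNReal}
    (hL : LipschitzOnWith L v C) {z z' : E} {t t' m : ℝ} (hm : 0 ≤ m) (h : (z, t) ∈ C)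
    (h' : (z', t') ∈ C) :
    ⟪v (z', t') - v (z, t), m • (z - z')⟫ ≤ L * (m * (‖z - z'‖ ^ 2 + (t - t') ^ 2)) := by
  refine (real_inner_le_norm _ _).trans ?_
  have h1 := hL.norm_sub_le h' h
  have h2 : ‖((z', t') : E × ℝ) - (z, t)‖ * ‖z - z'‖ ≤ ‖z - z'‖ ^ 2 + (t - t') ^ 2 := by
    rw [Prod.mk_sub_mk, Prod.norm_mk, Real.norm_eq_abs, norm_sub_rev z' z, abs_sub_comm,
      ← sq_abs (t - t')]
    rcases max_cases ‖z - z'‖ |t - t'| with h | h <;> rw [h.1] <;>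
      nlinarith [norm_nonneg (z - z'), abs_nonneg (t - t')]
  calc ‖v (z', t') - v (z, t)‖ * ‖m • (z - z')‖
      ≤ (L * ‖((z', t') : E × ℝ) - (z, t)‖) * (m * ‖z - z'‖) := by
        rw [norm_smul, Real.norm_of_nonneg hm]; gcongr
    _ = L * (m * (‖((z', t') : E × ℝ) - (z, t)‖ * ‖z - z'‖)) := by ring
    _ ≤ _ := by gcongr

/-- Local comparison principle: it is enough to compare the data in the domain of dependence. -/
theorem comparison [ProperSpace E] {v : E × ℝ → E}
    (hvb : ∀ q : E × ℝ, 0 ≤ q.2 → ‖v q‖ ≤ 1)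
    (hvL : ∀ C : Set (E × ℝ), C ⊆ {q | 0 ≤ q.2} → IsCompact C → ∃ L, LipschitzOnWith L v C)
    {A B : E × ℝ → ℝ} (hA : UpperSemicontinuousOn A {q | 0 ≤ q.2})
    (hB : LowerSemicontinuousOn B {q | 0 ≤ q.2}) (hAs : IsSub v A) (hBs : IsSuper v B)
    {p : E × ℝ} (hp : 0 < p.2)
    (h0 : ∀ z, ‖z - p.1‖ ≤ 2 * p.2 + 2 → A (z, 0) ≤ B (z, 0)) : A p ≤ B p := by
  by_contra! hlt
  obtain ⟨z₀, t₀⟩ := p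
  simp only at hp h0
  -- The gap is `3 * σ` and the penalty at `(z₀, t₀)` will be `2 * σ`, so the penalized gap there is
  -- still `σ`.
  set σ : ℝ := (A (z₀, t₀) - B (z₀, t₀)) / 3 with hσ
  have hσ0 : 0 < σ := by rw [hσ]; linarith
  -- With `smoothDist z₀ z₀ = 1`, the exponent in the penalty vanishes at `(z₀, t₀)`. The cone
  -- `smoothDist + 2t ≤ s₀ + 1` meets `t = 0` inside the ball of radius `2 * t₀ + 2`.
  set s₀ : ℝ := 1 + 2 * t₀ with hs₀
  let C : Set (E × ℝ) := {q | 0 ≤ q.2 ∧ smoothDist z₀ q.1 + 2 * q.2 ≤ s₀ + 1}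
  have hcs : Continuous (smoothDist z₀) := (contDiff_smoothDist z₀ (n := 0)).continuous
  have hcs2 : Continuous fun q : E × ℝ => smoothDist z₀ q.1 + 2 * q.2 := by fun_prop
  have hCS : C ⊆ {q | 0 ≤ q.2} := fun q hq => hq.1
  have hCc : IsClosed C :=
    (isClosed_le continuous_const continuous_snd).inter
      (isClosed_le hcs2 continuous_const)
  have hC : IsCompact C := by
    refine ((isCompact_closedBall z₀ (s₀ + 1)).prod (isCompact_Icc (a := (0 : ℝ))
      (b := s₀ + 1))).of_isClosed_subset hCc ?_
    rintro ⟨z, t⟩ ⟨h1, h2⟩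
    have h3 := norm_sub_le_smoothDist z₀ z
    have h4 := one_le_smoothDist z₀ z
    simp only at h1 h2
    refine ⟨?_, h1, ?_⟩
    · rw [mem_closedBall_iff_norm]; linarith
    · simp only; linarith
  have hpC : (z₀, t₀) ∈ C := by
    refine ⟨hp.le, ?_⟩
    simp [smoothDist, hs₀]
  have hAC := hA.mono hCS
  have hBC := hB.mono hCS
  obtain ⟨qA, -, hqA⟩ := hAC.exists_isMaxOn ⟨_, hpC⟩ hC
  obtain ⟨qB, -, hqB⟩ := hBC.exists_isMinOn ⟨_, hpC⟩ hC
  set D : ℝ := A qA - B qB with hD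
  have hDb : ∀ q ∈ C, ∀ q' ∈ C, A q - B q' ≤ D := fun q hq q' hq' => by
    have h1 : A q ≤ A qA := hqA hq
    have h2 : B qB ≤ B q' := hqB hq'
    linarith
  -- On the lateral boundary the exponent is `N`, so the penalty there exceeds every possible value
  -- `D` of the gap.
  obtain ⟨N, hN0, hN⟩ : ∃ N : ℝ, 0 < N ∧ D ≤ σ * Real.exp N := by
    refine ⟨max 1 (D / σ), by positivity, ?_⟩
    have h1 : D / σ ≤ Real.exp (max 1 (D / σ)) :=
      (le_max_right _ _).trans ((by linarith [Real.add_one_le_exp (max 1 (D / σ))]))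
    rw [div_le_iff₀ hσ0] at h1
    linarith
  set κ : ℝ := σ / t₀ with hκ
  have hκ0 : 0 < κ := by positivity
  let K : E × ℝ → ℝ := conePenalty κ σ N s₀ z₀
  have hKc : Continuous K := (contDiff_conePenalty κ σ N s₀ z₀).continuous
  have hKpos : ∀ q : E × ℝ, 0 ≤ q.2 → 0 < K q := fun q hq => by
    simp only [K, conePenalty]; positivity
  have hKp : K (z₀, t₀) = 2 * σ := by
    simp only [K, conePenalty, smoothDist, hs₀, hκ]
    simp
    field_simp
    norm_num
  have hAc' : ∀ q ∈ C, ∀ c, A q < c → ∀ᶠ q' in 𝓝[C] q, A q' < c := fun q hq c hc => hAC q hq c hc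
  have hBc' : ∀ q ∈ C, ∀ c, c < B q → ∀ᶠ q' in 𝓝[C] q, c < B q' := fun q hq c hc => hBC q hq c hc
  -- the doubled functional attains its maximum
  let pen : (E × ℝ) → (E × ℝ) → ℝ := fun q q' => ‖q.1 - q'.1‖ ^ 2 + (q.2 - q'.2) ^ 2
  let Φ : ℕ → (E × ℝ) × (E × ℝ) → ℝ := fun n Q =>
    A Q.1 - B Q.2 - K Q.1 - n / 2 * pen Q.1 Q.2
  have hmax : ∀ n : ℕ, ∃ Q ∈ C ×ˢ C, IsMaxOn (Φ n) (C ×ˢ C) Q := by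
    intro n
    refine UpperSemicontinuousOn.exists_isMaxOn ⟨((z₀, t₀), (z₀, t₀)), hpC, hpC⟩ (hC.prod hC) ?_
    have h1 : UpperSemicontinuousOn (fun Q : (E × ℝ) × (E × ℝ) => A Q.1) (C ×ˢ C) :=
      fun Q hQ c hc => (continuous_fst.continuousWithinAt.tendsto_nhdsWithin
        (fun R hR => hR.1)).eventually (hAC Q.1 hQ.1 c hc)
    have h2 : UpperSemicontinuousOn (fun Q : (E × ℝ) × (E × ℝ) => -B Q.2) (C ×ˢ C) :=
      fun Q hQ c hc => by
        have := ((continuous_snd.continuousWithinAt (s := C ×ˢ C) (x := Q)).tendsto_nhdsWithin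
          (fun R hR => hR.2)).eventually (hBc' Q.2 hQ.2 (-c) (by simp only at hc; linarith))
        exact this.mono fun R hR => by simp only; linarith
    have h3 : Continuous (fun Q : (E × ℝ) × (E × ℝ) => -K Q.1 - n / 2 * pen Q.1 Q.2) := by
      simp only [pen]
      fun_prop
    have := (h1.add h2).add (h3.upperSemicontinuous.upperSemicontinuousOn (C ×ˢ C))
    refine fun Q hQ c hc => (this Q hQ c (by simp only [Φ] at hc ⊢; linarith)).mono fun R hR => ?_
    simp only [Φ] at hR ⊢
    linarith
  choose Q hQC hQmax using hmax
  obtain ⟨Qb, hQb, ψ, hψ, hlim⟩ := (hC.prod hC).tendsto_subseq hQC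
  have hψat : Tendsto (fun n => (ψ n : ℝ)) atTop atTop :=
    tendsto_natCast_atTop_atTop.comp hψ.tendsto_atTop
  have hΦge : ∀ n, ∀ q ∈ C, A q - B q - K q ≤ Φ n (Q n) := fun n q hq => by
    have : Φ n (q, q) ≤ Φ n (Q n) := hQmax n (show (q, q) ∈ C ×ˢ C from ⟨hq, hq⟩)
    simpa [Φ, pen] using this
  have hΦσ : ∀ n, σ ≤ Φ n (Q n) := fun n => by
    have := hΦge n _ hpC
    rw [hKp] at this
    linarith
  have hpenb : ∀ n : ℕ, (n : ℝ) / 2 * pen (Q n).1 (Q n).2 ≤ D := fun n => by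
    have h1 := hΦσ n
    have h2 := hDb _ (hQC n).1 _ (hQC n).2
    have h3 := hKpos _ (hQC n).1.1
    simp only [Φ] at h1
    linarith
  have hl1 : Tendsto (fun n => (Q (ψ n)).1) atTop (𝓝 Qb.1) :=
    (continuous_fst.tendsto Qb).comp hlim
  have hl2 : Tendsto (fun n => (Q (ψ n)).2) atTop (𝓝 Qb.2) :=
    (continuous_snd.tendsto Qb).comp hlim
  have hpenc : Continuous fun Q : (E × ℝ) × (E × ℝ) => pen Q.1 Q.2 := by
    simp only [pen]; fun_prop
  have hdiag : Qb.1 = Qb.2 := by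
    have h1 : Tendsto (fun n => pen (Q (ψ n)).1 (Q (ψ n)).2) atTop (𝓝 (pen Qb.1 Qb.2)) :=
      (hpenc.tendsto Qb).comp hlim
    have h2 : Tendsto (fun n => 2 * D / (ψ n : ℝ)) atTop (𝓝 0) := hψat.const_div_atTop _
    have h3 : pen Qb.1 Qb.2 ≤ 0 := by
      refine le_of_tendsto_of_tendsto h1 h2 ?_
      filter_upwards [hψat.eventually_gt_atTop 0] with n hn
      rw [le_div_iff₀ hn]
      linarith [hpenb (ψ n)]
    have h4 : ‖Qb.1.1 - Qb.2.1‖ ^ 2 + (Qb.1.2 - Qb.2.2) ^ 2 ≤ 0 := h3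
    have h5 : ‖Qb.1.1 - Qb.2.1‖ ^ 2 = 0 := by
      linarith [sq_nonneg ‖Qb.1.1 - Qb.2.1‖, sq_nonneg (Qb.1.2 - Qb.2.2)]
    have h6 : (Qb.1.2 - Qb.2.2) ^ 2 = 0 := by
      linarith [sq_nonneg ‖Qb.1.1 - Qb.2.1‖, sq_nonneg (Qb.1.2 - Qb.2.2)]
    refine Prod.ext ?_ ?_
    · simpa [sub_eq_zero] using h5
    · simpa [sub_eq_zero] using h6
  obtain ⟨q, q'⟩ := Qb
  simp only at hdiag hl1 hl2
  subst hdiag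
  have hqC : q ∈ C := hQb.1
  have hl1' : Tendsto (fun n => (Q (ψ n)).1) atTop (𝓝[C] q) :=
    tendsto_nhdsWithin_iff.2 ⟨hl1, .of_forall fun n => (hQC _).1⟩
  have hl2' : Tendsto (fun n => (Q (ψ n)).2) atTop (𝓝[C] q) :=
    tendsto_nhdsWithin_iff.2 ⟨hl2, .of_forall fun n => (hQC _).2⟩
  have husc : ∀ δ > 0, ∀ᶠ n in atTop,
      A (Q (ψ n)).1 - B (Q (ψ n)).2 - K (Q (ψ n)).1 ≤ A q - B q - K q + δ := by
    intro δ hδ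
    filter_upwards [hl1'.eventually (hAc' q hqC (A q + δ / 3) (by linarith)),
      hl2'.eventually (hBc' q hqC (B q - δ / 3) (by linarith)),
      ((hKc.tendsto q).comp hl1).eventually_const_lt (show K q - δ / 3 < K q by linarith)]
      with n h1 h2 h3
    simp only [Function.comp] at h3
    linarith
  -- Comparing the maximum with the diagonal point `(q, q)` and using semicontinuity forces the
  -- doubling penalty to zero, not merely to stay bounded.
  have hpenlim : ∀ δ > 0, ∀ᶠ n in atTop, (ψ n : ℝ) / 2 * pen (Q (ψ n)).1 (Q (ψ n)).2 ≤ δ := by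
    intro δ hδ
    filter_upwards [husc δ hδ] with n hn
    have := hΦge (ψ n) q hqC
    simp only [Φ] at this
    linarith
  have hmq : σ ≤ A q - B q - K q := by
    refine le_of_forall_pos_le_add fun δ hδ => ?_
    obtain ⟨n, hn⟩ := (husc δ hδ).exists
    have h1 := hΦσ (ψ n)
    have h2 : (0 : ℝ) ≤ (ψ n : ℝ) / 2 * pen (Q (ψ n)).1 (Q (ψ n)).2 := by positivity
    simp only [Φ] at h1
    linarith
  -- the limit point is interior
  have hq0 : 0 < q.2 := by
    refine lt_of_le_of_ne hqC.1 fun h => ?_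
    have h1 : q = (q.1, 0) := Prod.ext rfl h.symm
    have h2 := h0 q.1 (by
      have h3 := norm_sub_le_smoothDist z₀ q.1
      have h4 := hqC.2
      rw [← h] at h4
      linarith)
    rw [← h1] at h2
    linarith [hKpos q hqC.1]
  have hqs : smoothDist z₀ q.1 + 2 * q.2 < s₀ + 1 := by
    by_contra! h
    have h1 : Real.exp N ≤ Real.exp (N * (smoothDist z₀ q.1 + 2 * q.2 - s₀)) :=
      Real.exp_le_exp.2 (le_mul_of_one_le_right hN0.le (by linarith))
    have h2 : D < K q := by
      have : σ * Real.exp N ≤ σ * Real.exp (N * (smoothDist z₀ q.1 + 2 * q.2 - s₀)) := by gcongr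
      simp only [K, conePenalty]
      nlinarith
    linarith [hDb q hqC q hqC]
  let I : Set (E × ℝ) := {q | 0 < q.2 ∧ smoothDist z₀ q.1 + 2 * q.2 < s₀ + 1}
  have hIo : IsOpen I := (isOpen_lt continuous_const continuous_snd).inter
      (isOpen_lt hcs2 continuous_const)
  have hIC : I ⊆ C := fun q hq => ⟨hq.1.le, hq.2.le⟩
  obtain ⟨L, hL⟩ := hvL C hCS hC
  have hLpos : (0 : ℝ) < L + 1 := by positivity
  -- This threshold makes the drift error at most `κ / 2`, contradicting the lower bound `κ`.
  obtain ⟨n, ⟨hn1, hn2⟩, hn3⟩ := ((hl1.eventually (hIo.mem_nhds ⟨hq0, hqs⟩)).and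
    (hl2.eventually (hIo.mem_nhds ⟨hq0, hqs⟩))).and
    (hpenlim (κ / 4 / (L + 1)) (by positivity)) |>.exists
  set m : ℕ := ψ n
  have hQm := hQmax m
  generalize hR : Q m = R at *
  obtain ⟨⟨z, t⟩, ⟨z', t'⟩⟩ := R
  simp only at hn1 hn2 hn3
  have hκle := le_inner_of_doubling (κ := κ) (σ := σ) (N := N) (s₀ := s₀) (z₀ := z₀) (m := m)
    (z := z) (z' := z') (t := t) (t' := t')
    hAs hBs hσ0 hN0 hn1.1 hn2.1 (hvb _ hn1.1.le) (by
      filter_upwards [hIo.mem_nhds hn1] with q hq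
      have h1 : Φ m (q, (z', t')) ≤ Φ m ((z, t), (z', t')) :=
        hQm (show (q, (z', t')) ∈ C ×ˢ C from ⟨hIC hq, hIC hn2⟩)
      simp only [Φ, pen, K] at h1
      linarith) (by
      filter_upwards [hIo.mem_nhds hn2] with q hq
      have h1 : Φ m ((z, t), q) ≤ Φ m ((z, t), (z', t')) :=
        hQm (show ((z, t), q) ∈ C ×ˢ C from ⟨hIC hn1, hIC hq⟩)
      simp only [Φ, pen] at h1
      rw [norm_sub_rev q.1 z, norm_sub_rev z' z, sub_sq_comm q.2, sub_sq_comm t']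
      linarith)
  have hle := inner_smul_sub_le_of_lipschitz hL (Nat.cast_nonneg m) (hIC hn1) (hIC hn2)
  rw [le_div_iff₀ hLpos] at hn3
  have hmp : 0 ≤ m * pen (z, t) (z', t') := by positivity
  simp only [pen] at hn3 hmp
  nlinarith

end Comparison

/-! ### Semicontinuous envelopes of locally bounded functions. -/

section Envelopes

variable {X : Type*} [TopologicalSpace X] {S : Set X} {f : X → ℝ}

/-- The two-sided local bound is needed because a real-valued `limsup` takes a default value when
boundedness or coboundedness fails. -/
lemma upperEnv_le {p : X} {c C : ℝ} (hp : p ∈ S) (hb : ∀ᶠ q in 𝓝[S] p, |f q| ≤ C)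
    (h : ∀ᶠ q in 𝓝[S] p, f q ≤ c) : upperEnv S f p ≤ c := by
  have := mem_closure_iff_nhdsWithin_neBot.1 (subset_closure hp)
  refine limsup_le_of_le (IsBoundedUnder.isCoboundedUnder_le ⟨-C, ?_⟩) h
  exact hb.mono fun q hq => (abs_le.1 hq).1

lemma le_lowerEnv {p : X} {c C : ℝ} (hp : p ∈ S) (hb : ∀ᶠ q in 𝓝[S] p, |f q| ≤ C)
    (h : ∀ᶠ q in 𝓝[S] p, c ≤ f q) : c ≤ lowerEnv S f p := by
  have := mem_closure_iff_nhdsWithin_neBot.1 (subset_closure hp)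
  refine le_liminf_of_le (IsBoundedUnder.isCoboundedUnder_ge ⟨C, ?_⟩) h
  exact hb.mono fun q hq => (abs_le.1 hq).2

lemma le_upperEnv {p : X} {C : ℝ} (hp : p ∈ S) (hb : ∀ᶠ q in 𝓝[S] p, |f q| ≤ C) :
    f p ≤ upperEnv S f p :=
  le_limsup_of_le ⟨C, hb.mono fun _ hq => (abs_le.1 hq).2⟩ fun _ hc => hc.self_of_nhdsWithin hp

lemma lowerEnv_le {p : X} {C : ℝ} (hp : p ∈ S) (hb : ∀ᶠ q in 𝓝[S] p, |f q| ≤ C) :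
    lowerEnv S f p ≤ f p :=
  liminf_le_of_le ⟨-C, hb.mono fun _ hq => (abs_le.1 hq).1⟩ fun _ hc => hc.self_of_nhdsWithin hp

lemma upperSemicontinuousOn_upperEnv (hb : ∀ p ∈ S, ∃ C, ∀ᶠ q in 𝓝[S] p, |f q| ≤ C) :
    UpperSemicontinuousOn (upperEnv S f) S := by
  intro p hp c hc
  obtain ⟨C, hC⟩ := hb p hp
  obtain ⟨c', hc1, hc2⟩ := exists_between (show upperEnv S f p < c from hc)
  have h1 : ∀ᶠ q in 𝓝[S] p, f q < c' :=
    eventually_lt_of_limsup_lt hc1 ⟨C, hC.mono fun q hq => (abs_le.1 hq).2⟩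
  filter_upwards [eventually_eventually_nhdsWithin.2 (h1.and hC), self_mem_nhdsWithin] with q hq hqS
  exact (upperEnv_le hqS (hq.mono fun _ h => h.2) (hq.mono fun _ h => h.1.le)).trans_lt hc2

lemma lowerSemicontinuousOn_lowerEnv (hb : ∀ p ∈ S, ∃ C, ∀ᶠ q in 𝓝[S] p, |f q| ≤ C) :
    LowerSemicontinuousOn (lowerEnv S f) S := by
  intro p hp c hc
  obtain ⟨C, hC⟩ := hb p hp
  obtain ⟨c', hc1, hc2⟩ := exists_between (show c < lowerEnv S f p from hc)
  have h1 : ∀ᶠ q in 𝓝[S] p, c' < f q :=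
    eventually_lt_of_lt_liminf hc2 ⟨-C, hC.mono fun q hq => (abs_le.1 hq).1⟩
  filter_upwards [eventually_eventually_nhdsWithin.2 (h1.and hC), self_mem_nhdsWithin] with q hq hqS
  exact hc1.trans_le (le_lowerEnv hqS (hq.mono fun _ h => h.2) (hq.mono fun _ h => h.1.le))

lemma eventually_abs_le_of_between {l g : X → ℝ} {p : X} (hl : ContinuousAt l p)
    (hg : ContinuousAt g p) (h : ∀ q, l q ≤ f q ∧ f q ≤ g q) :
    ∃ C, ∀ᶠ q in 𝓝 p, |f q| ≤ C := by
  refine ⟨max (-(l p - 1)) (g p + 1), ?_⟩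
  filter_upwards [hl.eventually_const_lt (show l p - 1 < l p by linarith),
    hg.eventually_lt_const (show g p < g p + 1 by linarith)] with q h1 h2
  have := h q
  refine abs_le'.2 ⟨le_max_of_le_right (by linarith), le_max_of_le_left (by linarith)⟩

lemma upperEnv_univ_le {l g : X → ℝ} {p : X} (hl : ContinuousAt l p)
    (hg : ContinuousAt g p) (h : ∀ q, l q ≤ f q ∧ f q ≤ g q) : upperEnv univ f p ≤ g p := by
  obtain ⟨C, hC⟩ := eventually_abs_le_of_between hl hg h
  rw [← nhdsWithin_univ] at hC
  refine le_of_forall_pos_le_add fun δ hδ => upperEnv_le (mem_univ p) hC ?_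
  rw [nhdsWithin_univ]
  filter_upwards [hg.eventually_lt_const (show g p < g p + δ by linarith)] with q hq
  exact (h q).2.trans hq.le

lemma le_lowerEnv_univ {l g : X → ℝ} {p : X} (hl : ContinuousAt l p)
    (hg : ContinuousAt g p) (h : ∀ q, l q ≤ f q ∧ f q ≤ g q) : l p ≤ lowerEnv univ f p := by
  obtain ⟨C, hC⟩ := eventually_abs_le_of_between hl hg h
  rw [← nhdsWithin_univ] at hC
  refine le_of_forall_pos_sub_le fun δ hδ => le_lowerEnv (mem_univ p) hC ?_
  rw [nhdsWithin_univ]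
  filter_upwards [hl.eventually_const_lt (show l p - δ < l p by linarith)] with q hq
  exact hq.le.trans (h q).1

end Envelopes

lemma IsBarrier.strictMono {g : ℝ → ℝ} (hg : IsBarrier g) : StrictMono g := by
  have hc : Continuous g := hg.locallyLipschitz.continuous
  refine StrictMonoOn.Iic_union_Ici (a := 0) ?_ ?_
  · refine strictMonoOn_of_deriv_pos (convex_Iic 0) hc.continuousOn fun y hy => ?_
    rw [interior_Iic] at hy
    exact hg.deriv_pos y hy.ne
  · refine strictMonoOn_of_deriv_pos (convex_Ici 0) hc.continuousOn fun y hy => ?_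
    rw [interior_Ici] at hy
    exact hg.deriv_pos y hy.ne'

variable {d : ℕ}

lemma continuous_snd_pt : Continuous fun z : Pt d => z.snd := (WithLp.sndL 2 ℝ (Tr d) ℝ).continuous

lemma abs_snd_le (z : Pt d) : |z.snd| ≤ ‖z‖ := by
  refine abs_le_of_sq_le_sq ?_ (norm_nonneg z)
  rw [WithLp.prod_norm_sq_eq_of_L2, Real.norm_eq_abs, sq_abs]
  linarith [sq_nonneg ‖z.fst‖]

/-- The drift of the G-equation as a function on space-time. -/
def drift (ε : ℝ) (α : ℝ≥0∞) (u : Pt d → ℝ → Pt d) (q : Pt d × ℝ) : Pt d :=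
  ε • u q.1 (epsPow ε α * q.2)

lemma gOperator_eq_hamOp (ε : ℝ) (α : ℝ≥0∞) (u : Pt d → ℝ → Pt d) (φ : Pt d × ℝ → ℝ)
    (p : Pt d × ℝ) : gOperator ε α u φ p = hamOp (drift ε α u) φ p := by
  simp only [gOperator, hamOp, drift, real_inner_smul_left]

section Solutions

variable {ε : ℝ} {α : ℝ≥0∞} {u : Pt d → ℝ → Pt d} {G₀ : Pt d → ℝ} {G : Pt d × ℝ → ℝ}

lemma SolvesGEquation.isSub (h : SolvesGEquation ε α u G₀ G) :
    IsSub (drift ε α u) (upperEnv (spaceTime d) G) := fun p hp φ hφ hm =>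
  gOperator_eq_hamOp ε α u φ p ▸ h.subsolution p hp φ hφ hm

lemma SolvesGEquation.isSuper (h : SolvesGEquation ε α u G₀ G) :
    IsSuper (drift ε α u) (lowerEnv (spaceTime d) G) := fun p hp φ hφ hm =>
  gOperator_eq_hamOp ε α u φ p ▸ h.supersolution p hp φ hφ hm

lemma SolvesGEquation.eventually_abs_le (h : SolvesGEquation ε α u G₀ G) (p : Pt d × ℝ) :
    ∃ C, ∀ᶠ q in 𝓝[spaceTime d] p, |G q| ≤ C := by
  have hc : IsClosed (spaceTime d) := isClosed_le continuous_const continuous_snd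
  obtain ⟨C, hC⟩ := h.locallyBounded (Metric.closedBall p 1 ∩ spaceTime d) inter_subset_right
    ((isCompact_closedBall p 1).inter_right hc)
  refine ⟨C, ?_⟩
  filter_upwards [self_mem_nhdsWithin,
    mem_nhdsWithin_of_mem_nhds (Metric.closedBall_mem_nhds p one_pos)] with q h1 h2
  exact hC q ⟨h2, h1⟩

end Solutions

/-! ### Sign comparison for front-like data. -/

section Fronts

variable {v : Pt d × ℝ → Pt d} {A U : Pt d × ℝ → ℝ} {g l : ℝ → ℝ}

/-- Compare `A` with `δ * exp (N * U)`, whose value is at most `δ` where `U ≤ 0`, then let `δ → 0`.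
-/
lemma sub_nonpos_of_super_nonpos (hvb : ∀ q : Pt d × ℝ, 0 ≤ q.2 → ‖v q‖ ≤ 1)
    (hvL : ∀ C : Set (Pt d × ℝ), C ⊆ {q | 0 ≤ q.2} → IsCompact C → ∃ L, LipschitzOnWith L v C)
    (hA : UpperSemicontinuousOn A {q | 0 ≤ q.2}) (hU : LowerSemicontinuousOn U {q | 0 ≤ q.2})
    (hAs : IsSub v A) (hUs : IsSuper v U) (hg : IsBarrier g) (hl : IsBarrier l)
    (hA0 : ∀ z, A (z, 0) ≤ g z.snd) (hU0 : ∀ z, l z.snd ≤ U (z, 0))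
    {p : Pt d × ℝ} (hp : 0 < p.2) (hUp : U p ≤ 0) : A p ≤ 0 := by
  refine le_of_forall_pos_le_add fun δ hδ => ?_
  rw [zero_add]
  obtain ⟨y₁, hy₁, hgy⟩ : ∃ y₁ > 0, g y₁ ≤ δ := by
    have h1 : ∀ᶠ y in 𝓝[>] (0 : ℝ), g y < δ :=
      nhdsWithin_le_nhds (hg.locallyLipschitz.continuous.continuousAt.eventually_lt_const
        (by rw [hg.zero]; exact hδ))
    obtain ⟨y, hy, hy'⟩ := (h1.and self_mem_nhdsWithin).exists
    exact ⟨y, hy', hy.le⟩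
  have hη : 0 < l y₁ := hl.zero ▸ hl.strictMono hy₁
  -- Largest height in the ball of dependence of `p`; `N` depends on `δ` and `p`, which is harmless
  -- because comparison is local.
  set R : ℝ := p.1.snd + 2 * p.2 + 2 with hR
  obtain ⟨N, hN0, hN⟩ : ∃ N : ℝ, 0 < N ∧ g R ≤ δ * Real.exp (N * l y₁) := by
    have hx : ∀ a : ℝ, a ≤ δ * Real.exp (a / δ) := fun a => by
      have := Real.add_one_le_exp (a / δ)
      have h2 : a / δ ≤ Real.exp (a / δ) := by linarith
      rw [div_le_iff₀ hδ] at h2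
      linarith
    refine ⟨max 1 (g R / δ / l y₁), by positivity, (hx (g R)).trans ?_⟩
    gcongr
    rw [← div_le_iff₀ hη]
    exact le_max_right _ _
  have hlsc : LowerSemicontinuousOn (fun q => δ * Real.exp (N * U q)) {q | 0 ≤ q.2} := by
    have hc : Continuous fun s => δ * Real.exp (N * s) := by fun_prop
    exact hc.comp_lowerSemicontinuousOn hU fun a b hab => by simp only; gcongr
  have key := comparison hvb hvL hA hlsc hAs (hUs.const_mul_exp hδ hN0) hp (by
    intro z hz
    have hzR : z.snd ≤ R := by
      have h1 := abs_snd_le (z - p.1)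
      rw [WithLp.sub_snd] at h1
      linarith [le_abs_self (z.snd - p.1.snd)]
    refine (hA0 z).trans ?_
    rcases le_total z.snd 0 with h | h
    · exact (hg.zero ▸ hg.strictMono.monotone h).trans (by positivity)
    · rcases le_total z.snd y₁ with h' | h'
      · refine ((hg.strictMono.monotone h').trans hgy).trans ?_
        refine le_mul_of_one_le_right hδ.le (Real.one_le_exp ?_)
        exact mul_nonneg hN0.le ((hl.zero ▸ hl.strictMono.monotone h).trans (hU0 z))
      · refine ((hg.strictMono.monotone hzR).trans hN).trans ?_
        have := (hl.strictMono.monotone h').trans (hU0 z)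
        gcongr)
  refine key.trans (mul_le_of_le_one_right hδ.le (Real.exp_le_one_iff.2 ?_))
  exact mul_nonpos_of_nonneg_of_nonpos hN0.le hUp

/-- The mirror image: the subsolution is relabeled to `-(δ * exp (-(N * A)))`, which is at least
`-δ` where `A ≥ 0`. -/
lemma super_nonneg_of_sub_nonneg (hvb : ∀ q : Pt d × ℝ, 0 ≤ q.2 → ‖v q‖ ≤ 1)
    (hvL : ∀ C : Set (Pt d × ℝ), C ⊆ {q | 0 ≤ q.2} → IsCompact C → ∃ L, LipschitzOnWith L v C)
    (hA : UpperSemicontinuousOn A {q | 0 ≤ q.2}) (hU : LowerSemicontinuousOn U {q | 0 ≤ q.2})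
    (hAs : IsSub v A) (hUs : IsSuper v U) (hg : IsBarrier g) (hl : IsBarrier l)
    (hA0 : ∀ z, A (z, 0) ≤ g z.snd) (hU0 : ∀ z, l z.snd ≤ U (z, 0))
    {p : Pt d × ℝ} (hp : 0 < p.2) (hAp : 0 ≤ A p) : 0 ≤ U p := by
  refine le_of_forall_pos_sub_le fun δ hδ => ?_
  rw [zero_sub]
  obtain ⟨y₁, hy₁, hly⟩ : ∃ y₁ < 0, -δ ≤ l y₁ := by
    have h1 : ∀ᶠ y in 𝓝[<] (0 : ℝ), -δ < l y :=
      nhdsWithin_le_nhds (hl.locallyLipschitz.continuous.continuousAt.eventually_const_lt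
        (by rw [hl.zero]; linarith))
    obtain ⟨y, hy, hy'⟩ := (h1.and self_mem_nhdsWithin).exists
    exact ⟨y, hy', hy.le⟩
  have hη : 0 < -g y₁ := neg_pos.2 (hg.zero ▸ hg.strictMono hy₁)
  set R : ℝ := p.1.snd - (2 * p.2 + 2) with hR
  obtain ⟨N, hN0, hN⟩ : ∃ N : ℝ, 0 < N ∧ -l R ≤ δ * Real.exp (N * -g y₁) := by
    have hx : ∀ a : ℝ, a ≤ δ * Real.exp (a / δ) := fun a => by
      have := Real.add_one_le_exp (a / δ)
      have h2 : a / δ ≤ Real.exp (a / δ) := by linarith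
      rw [div_le_iff₀ hδ] at h2
      linarith
    refine ⟨max 1 (-l R / δ / -g y₁), by positivity, (hx (-l R)).trans ?_⟩
    gcongr
    rw [← div_le_iff₀ hη]
    exact le_max_right _ _
  have husc : UpperSemicontinuousOn (fun q => -(δ * Real.exp (-(N * A q)))) {q | 0 ≤ q.2} := by
    have hc : Continuous fun s => -(δ * Real.exp (-(N * s))) := by fun_prop
    exact hc.comp_upperSemicontinuousOn hA fun a b hab => by simp only; gcongr
  have key := comparison hvb hvL husc hU (hAs.neg_const_mul_exp hδ hN0) hUs hp (by
    intro z hz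
    have hzR : R ≤ z.snd := by
      have h1 := abs_snd_le (z - p.1)
      rw [WithLp.sub_snd] at h1
      linarith [neg_abs_le (z.snd - p.1.snd)]
    refine le_trans ?_ (hU0 z)
    rw [neg_le]
    rcases le_total 0 z.snd with h | h
    · exact (neg_nonpos.2 (hl.zero ▸ hl.strictMono.monotone h)).trans (by positivity)
    · rcases le_total y₁ z.snd with h' | h'
      · have h2 := hl.strictMono.monotone h'
        refine (show -l z.snd ≤ δ by linarith).trans ?_
        refine le_mul_of_one_le_right hδ.le (Real.one_le_exp ?_)
        have h3 : A (z, 0) ≤ 0 := (hA0 z).trans (hg.zero ▸ hg.strictMono.monotone h)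
        rw [← mul_neg]
        exact mul_nonneg hN0.le (neg_nonneg.2 h3)
      · refine ((neg_le_neg (hl.strictMono.monotone hzR)).trans hN).trans ?_
        have := (hA0 z).trans (hg.strictMono.monotone h')
        rw [← mul_neg]
        gcongr)
  refine le_trans (neg_le_neg ?_) key
  refine mul_le_of_le_one_right hδ.le (Real.exp_le_one_iff.2 ?_)
  exact neg_nonpos.2 (mul_nonneg hN0.le hAp)

/-- Two solutions with front-like data have the same sign. -/
lemma sign_imp_of_frontLike {ε : ℝ} {α : ℝ≥0∞} {u : Pt d → ℝ → Pt d}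
    (hvb : ∀ q : Pt d × ℝ, 0 ≤ q.2 → ‖drift ε α u q‖ ≤ 1)
    (hvL : ∀ C : Set (Pt d × ℝ), C ⊆ {q | 0 ≤ q.2} → IsCompact C →
      ∃ L, LipschitzOnWith L (drift ε α u) C)
    {G₀ V₀ : Pt d → ℝ} {G V : Pt d × ℝ → ℝ} (hG₀ : IsFrontLike G₀) (hV₀ : IsFrontLike V₀)
    (hG : SolvesGEquation ε α u G₀ G) (hV : SolvesGEquation ε α u V₀ V)
    {p : Pt d × ℝ} (hp : 0 ≤ p.2) : (V p ≤ 0 → G p ≤ 0) ∧ (0 ≤ G p → 0 ≤ V p) := by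
  obtain ⟨l₁, g₁, hl₁, hg₁, h₁⟩ := hG₀.barriers
  obtain ⟨l₂, g₂, hl₂, hg₂, h₂⟩ := hV₀.barriers
  -- At time zero the signs are read off directly: the barriers make each datum positive above and
  -- negative below the plane, and zero on it.
  rcases hp.eq_or_lt with h0 | hpos
  · have hpe : p = (p.1, 0) := Prod.ext rfl h0.symm
    rw [hpe, hG.initial, hV.initial]
    refine ⟨fun h => ?_, fun h => ?_⟩
    · have h3 : l₂ p.1.snd ≤ l₂ 0 := by rw [hl₂.zero]; exact (h₂ _).1.trans h
      have h4 := hg₁.strictMono.monotone (hl₂.strictMono.le_iff_le.1 h3)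
      rw [hg₁.zero] at h4
      exact (h₁ _).2.trans h4
    · have h3 : g₁ 0 ≤ g₁ p.1.snd := by rw [hg₁.zero]; exact h.trans (h₁ _).2
      have h4 := hl₂.strictMono.monotone (hg₁.strictMono.le_iff_le.1 h3)
      rw [hl₂.zero] at h4
      exact h4.trans (h₂ _).1
  · have hcont : ∀ {f : ℝ → ℝ}, IsBarrier f → ∀ z : Pt d, ContinuousAt (fun z : Pt d => f z.snd) z :=
      fun hf z => (hf.locallyLipschitz.continuous.comp continuous_snd_pt).continuousAt
    have hA0 : ∀ z, upperEnv (spaceTime d) G (z, 0) ≤ g₁ z.snd := fun z =>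
      (hG.initial_upper z).trans (upperEnv_univ_le (hcont hl₁ z) (hcont hg₁ z) h₁)
    have hU0 : ∀ z, l₂ z.snd ≤ lowerEnv (spaceTime d) V (z, 0) := fun z =>
      (le_lowerEnv_univ (hcont hl₂ z) (hcont hg₂ z) h₂).trans (hV.initial_lower z)
    have hA := upperSemicontinuousOn_upperEnv fun q _ => hG.eventually_abs_le q
    have hU := lowerSemicontinuousOn_lowerEnv fun q _ => hV.eventually_abs_le q
    obtain ⟨C, hC⟩ := hG.eventually_abs_le p
    obtain ⟨C', hC'⟩ := hV.eventually_abs_le p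
    have hGp := le_upperEnv (S := spaceTime d) hp hC
    have hVp := lowerEnv_le (S := spaceTime d) hp hC'
    exact ⟨fun h => hGp.trans (sub_nonpos_of_super_nonpos hvb hvL hA hU hG.isSub hV.isSuper hg₁ hl₂
        hA0 hU0 hpos (hVp.trans h)),
      fun h => (super_nonneg_of_sub_nonneg hvb hvL hA hU hG.isSub hV.isSuper hg₁ hl₂
        hA0 hU0 hpos (h.trans hGp)).trans hVp⟩

end Fronts

/-! ### Local Lipschitz regularity of the drift. -/

section Drift

lemma epsPow_nonneg {ε : ℝ} (hε : 0 < ε) (α : ℝ≥0∞) : 0 ≤ epsPow ε α := by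
  unfold epsPow
  split_ifs
  · exact le_rfl
  · positivity

/-- The drift is C¹ up to the boundary of the convex set `t ≥ 0`, hence locally Lipschitz there, and
Lipschitz on compact subsets. -/
lemma drift_lipschitzOn {ε : ℝ} (hε : 0 < ε) (α : ℝ≥0∞) {uperp : Tr d × ℝ × ℝ → Tr d}
    (huperp : ContDiffOn ℝ 1 uperp {q | 0 ≤ q.2.2}) {upar : Tr d × ℝ → ℝ}
    (hupar : ContDiffOn ℝ 1 upar {q | 0 ≤ q.2}) {w : ℝ → ℝ} (hw : ContDiff ℝ 1 w)
    {C : Set (Pt d × ℝ)} (hCS : C ⊆ {q | 0 ≤ q.2}) (hC : IsCompact C) :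
    ∃ L, LipschitzOnWith L (drift ε α (advection uperp upar w)) C := by
  have hk := epsPow_nonneg hε α
  have hfst : ContDiff ℝ 1 (fun q : Pt d × ℝ => q.1.fst) :=
    (WithLp.fstL 2 ℝ (Tr d) ℝ).contDiff.comp contDiff_fst
  have hsnd : ContDiff ℝ 1 (fun q : Pt d × ℝ => q.1.snd) :=
    (WithLp.sndL 2 ℝ (Tr d) ℝ).contDiff.comp contDiff_fst
  have ht : ContDiff ℝ 1 (fun q : Pt d × ℝ => epsPow ε α * q.2) :=
    contDiff_const.mul contDiff_snd
  have h1 : ContDiffOn ℝ 1 (fun q : Pt d × ℝ => uperp (q.1.fst, q.1.snd, epsPow ε α * q.2))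
      {q | 0 ≤ q.2} :=
    huperp.comp (hfst.prodMk (hsnd.prodMk ht)).contDiffOn fun q hq => mul_nonneg hk hq
  have h2 : ContDiffOn ℝ 1 (fun q : Pt d × ℝ => upar (q.1.fst, epsPow ε α * q.2) * w q.1.snd)
      {q | 0 ≤ q.2} :=
    (hupar.comp (hfst.prodMk ht).contDiffOn fun q hq => mul_nonneg hk hq).mul
      (hw.comp hsnd).contDiffOn
  have h3 : ContDiffOn ℝ 1 (drift ε α (advection uperp upar w)) {q : Pt d × ℝ | 0 ≤ q.2} :=
    ((WithLp.prodContinuousLinearEquiv 2 ℝ (Tr d) ℝ).symm.contDiff.comp_contDiffOn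
      (h1.prodMk h2)).const_smul ε
  have hconv : Convex ℝ {q : Pt d × ℝ | 0 ≤ q.2} :=
    convex_halfSpace_ge (LinearMap.snd ℝ (Pt d) ℝ).isLinear 0
  have h4 : LocallyLipschitzOn {q : Pt d × ℝ | 0 ≤ q.2} (drift ε α (advection uperp upar w)) :=
    fun q hq => (h3 q hq).exists_lipschitzOnWith hconv
  exact (h4.mono hCS).exists_lipschitzOnWith_of_compact hC

end Drift

/-! ### Linear growth of the planar metric solution. -/

section HalfSpace

variable {E : Type*} [NormedAddCommGroup E] [InnerProductSpace ℝ E]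

lemma abs_le_of_lipschitz_of_zero {e : E} (he : ‖e‖ = 1) {ρ : E → ℝ} {K : NNReal}
    (hK : LipschitzWith K ρ) (h0 : ∀ z, ⟪e, z⟫ = 0 → ρ z = 0) (z : E) :
    |ρ z| ≤ K * |⟪e, z⟫| := by
  have h1 : ρ (z - ⟪e, z⟫ • e) = 0 := by
    refine h0 _ ?_
    rw [inner_sub_right, inner_smul_right, real_inner_self_eq_norm_sq, he]
    ring
  have h2 := hK.norm_sub_le z (z - ⟪e, z⟫ • e)
  rwa [h1, sub_zero, sub_sub_cancel, norm_smul, he, mul_one, Real.norm_eq_abs,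
    Real.norm_eq_abs] at h2

/-- A Lipschitz viscosity supersolution of `c · ∇ρ + |∇ρ| ≥ 1` in a half space that vanishes on the
boundary and is asymptotically nonnegative grows at least linearly. -/
lemma half_mul_inner_le_of_supersolution [ProperSpace E] {e : E} (he : ‖e‖ = 1) {c : E → E}
    (hc : ∀ z, ‖c z‖ ≤ 1 / 100) {ρ : E → ℝ} {K : NNReal} (hK : LipschitzWith K ρ)
    (h0 : ∀ z, ⟪e, z⟫ = 0 → ρ z = 0)
    (hsup : ∀ z, 0 < ⟪e, z⟫ → ∀ φ : E → ℝ, ContDiffAt ℝ 1 φ z →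
      IsLocalMin (fun z' => ρ z' - φ z') z → 1 ≤ ⟪c z, gradient φ z⟫ + ‖gradient φ z‖)
    (hinf : ∀ δ > 0, ∃ R : ℝ, ∀ z, R ≤ ⟪e, z⟫ → -δ ≤ ρ z) {z₀ : E} (hz₀ : 0 < ⟪e, z₀⟫) :
    ⟪e, z₀⟫ / 2 ≤ ρ z₀ := by
  by_contra! hlt
  set y₀ : ℝ := ⟪e, z₀⟫ with hy₀
  set γ : ℝ := y₀ / 2 - ρ z₀ with hγ
  have hγ0 : 0 < γ := by rw [hγ]; linarith
  obtain ⟨R₁, hR₁⟩ := hinf (γ / 4) (by positivity)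
  -- Large enough that the parabola below loses at most `γ / 4` against `y₀ / 2` at `z₀`, and that
  -- `ρ ≥ -γ / 4` on the top face.
  set R : ℝ := max (max R₁ (y₀ + 1)) (2 * y₀ ^ 2 / γ) with hRdef
  have hRR₁ : R₁ ≤ R := (le_max_left _ _).trans (le_max_left _ _)
  have hRy : y₀ + 1 ≤ R := (le_max_right _ _).trans (le_max_left _ _)
  have hRγ : 2 * y₀ ^ 2 ≤ R * γ := (div_le_iff₀ hγ0).1 (le_max_right _ _)
  have hR0 : 0 < R := by linarith
  clear_value R
  -- The bound `γ / 8` preserves the strict deficit at `z₀`; the bound `1 / 4` keeps the total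
  -- gradient below `3 / 4`.
  set η : ℝ := min (γ / 8) (1 / 4) with hη
  have hη0 : 0 < η := by positivity
  have hη1 : η ≤ γ / 8 := min_le_left _ _
  have hη2 : η ≤ 1 / 4 := min_le_right _ _
  clear_value η
  -- A parabola vanishing on both faces `y = 0` and `y = R`, with slope at most `1 / 2` in absolute
  -- value. The term in `smoothDist` confines the minimum laterally.
  let f : ℝ → ℝ := fun y => y * (R - y) / (2 * R)
  let φ : E → ℝ := fun z => f ⟪e, z⟫ + -η * smoothDist z₀ z
  have hcs : Continuous (smoothDist z₀) := (contDiff_smoothDist z₀ (n := 0)).continuous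
  have hip : Continuous fun z : E => ⟪e, z⟫ := by fun_prop
  have hφc : ContDiff ℝ 1 φ := by
    have h1 : ContDiff ℝ 1 fun z : E => ⟪e, z⟫ := contDiff_const.inner ℝ contDiff_id
    exact ((h1.mul (contDiff_const.sub h1)).div_const _).add
      (contDiff_const.mul (contDiff_smoothDist z₀))
  have hFc : Continuous fun z => ρ z - φ z := hK.continuous.sub hφc.continuous
  -- Beyond this distance the localizing term outweighs `|ρ| ≤ K * R` and `f ≤ R`.
  set r : ℝ := (K * R + R) / η with hr
  have hr0 : 0 < r := by positivity
  let T : Set E := {z | 0 ≤ ⟪e, z⟫ ∧ ⟪e, z⟫ ≤ R} ∩ Metric.closedBall z₀ r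
  have hT : IsCompact T := (isCompact_closedBall z₀ r).inter_left
    ((isClosed_le continuous_const hip).inter (isClosed_le hip continuous_const))
  have hz₀T : z₀ ∈ T := ⟨⟨hz₀.le, by linarith⟩, Metric.mem_closedBall_self hr0.le⟩
  obtain ⟨z₁, hz₁, hmin⟩ := hT.exists_isMinOn ⟨z₀, hz₀T⟩ hFc.continuousOn
  have hF0 : ρ z₀ - φ z₀ < -(γ / 2) := by
    have h1 : φ z₀ = y₀ * (R - y₀) / (2 * R) - η := by
      simp [φ, f, smoothDist, hy₀, sub_eq_add_neg]
    have h2 : y₀ / 2 - γ / 4 ≤ y₀ * (R - y₀) / (2 * R) := by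
      rw [le_div_iff₀ (by positivity)]
      nlinarith
    linarith
  have hF1 : ρ z₁ - φ z₁ < -(γ / 2) := lt_of_le_of_lt (hmin hz₀T) hF0
  have hs1 : 0 ≤ η * smoothDist z₀ z₁ :=
    mul_nonneg hη0.le (zero_le_one.trans (one_le_smoothDist _ _))
  have hφ1 : φ z₁ = ⟪e, z₁⟫ * (R - ⟪e, z₁⟫) / (2 * R) - η * smoothDist z₀ z₁ := by
    simp [φ, f, sub_eq_add_neg]
  have hpos : 0 < ⟪e, z₁⟫ := by
    refine lt_of_le_of_ne hz₁.1.1 fun h => ?_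
    rw [hφ1, h0 z₁ h.symm, ← h, zero_mul, zero_div] at hF1
    linarith
  have hltR : ⟪e, z₁⟫ < R := by
    refine lt_of_le_of_ne hz₁.1.2 fun h => ?_
    have h2 := hR₁ z₁ (h ▸ hRR₁)
    rw [hφ1, h, sub_self, mul_zero, zero_div] at hF1
    linarith
  have hball : z₁ ∈ Metric.ball z₀ r := by
    rw [Metric.mem_ball, dist_eq_norm]
    by_contra! h
    have h2 := abs_le_of_lipschitz_of_zero he hK h0 z₁
    rw [abs_of_pos hpos] at h2
    have h3 : (K : ℝ) * ⟪e, z₁⟫ ≤ K * R := by gcongr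
    have h4 : ⟪e, z₁⟫ * (R - ⟪e, z₁⟫) / (2 * R) ≤ R := by
      rw [div_le_iff₀ (by positivity)]
      nlinarith
    have h5 : K * R + R ≤ η * smoothDist z₀ z₁ := by
      have := h.trans (norm_sub_le_smoothDist z₀ z₁)
      rw [hr, div_le_iff₀ hη0] at this
      linarith
    linarith [neg_abs_le (ρ z₁)]
  have hloc : IsLocalMin (fun z => ρ z - φ z) z₁ := by
    filter_upwards [Metric.isOpen_ball.mem_nhds hball,
      (isOpen_lt continuous_const hip).mem_nhds hpos,
      (isOpen_lt hip continuous_const).mem_nhds hltR] with z hz1 hz2 hz3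
    exact hmin (show z ∈ T from ⟨⟨le_of_lt hz2, le_of_lt hz3⟩, Metric.ball_subset_closedBall hz1⟩)
  have key := hsup z₁ hpos φ hφc.contDiffAt hloc
  have hgrad : HasGradientAt φ (((R - 2 * ⟪e, z₁⟫) / (2 * R)) • e
      + (-η) • ((smoothDist z₀ z₁)⁻¹ • (z₁ - z₀))) z₁ := by
    have h1 : HasGradientAt (fun z : E => ⟪e, z⟫) e z₁ := by
      rw [hasGradientAt_iff_hasFDerivAt]
      exact (InnerProductSpace.toDual ℝ E e).hasFDerivAt
    have h2 : HasDerivAt f ((R - 2 * ⟪e, z₁⟫) / (2 * R)) ⟪e, z₁⟫ := by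
      have := ((hasDerivAt_id ⟪e, z₁⟫).mul ((hasDerivAt_id ⟪e, z₁⟫).const_sub R)).div_const (2 * R)
      refine this.congr_deriv ?_
      simp only [id]
      ring
    refine hasGradientAt_add (hasGradientAt_comp h2 h1) ?_
    refine hasGradientAt_comp (F := fun s => -η * s) ?_ (hasGradientAt_smoothDist z₀ z₁)
    simpa using (hasDerivAt_id (smoothDist z₀ z₁)).const_mul (-η)
  rw [hgrad.gradient] at key
  set g := ((R - 2 * ⟪e, z₁⟫) / (2 * R)) • e + (-η) • ((smoothDist z₀ z₁)⁻¹ • (z₁ - z₀))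
  have hg : ‖g‖ ≤ 3 / 4 := by
    refine (norm_add_le _ _).trans ?_
    have h1 : ‖((R - 2 * ⟪e, z₁⟫) / (2 * R)) • e‖ ≤ 1 / 2 := by
      rw [norm_smul, he, mul_one, Real.norm_eq_abs, abs_le]
      constructor
      · rw [le_div_iff₀ (by positivity)]; linarith
      · rw [div_le_iff₀ (by positivity)]; linarith
    have h2 : ‖(-η) • ((smoothDist z₀ z₁)⁻¹ • (z₁ - z₀))‖ ≤ 1 / 4 := by
      rw [norm_smul, norm_neg, Real.norm_of_nonneg hη0.le]
      exact (mul_le_of_le_one_right hη0.le (norm_grad_smoothDist_le _ _)).trans hη2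
    linarith
  -- A test gradient of norm at most `3 / 4` gives at most `(1 + 1 / 100) * (3 / 4) < 1`, violating
  -- the supersolution inequality.
  have hcg : ⟪c z₁, g⟫ ≤ 1 / 100 * ‖g‖ :=
    (real_inner_le_norm _ _).trans (mul_le_mul_of_nonneg_right (hc z₁) (norm_nonneg g))
  linarith

end HalfSpace

/-- Piecewise linear functions with positive slopes are barriers. -/
lemma isBarrier_piecewise {a b : ℝ} (ha : 0 < a) (hb : 0 < b) :
    IsBarrier fun y => a * max y 0 + b * min y 0 := by
  have hpos : ∀ y : ℝ, 0 < y → (fun y => a * max y 0 + b * min y 0) =ᶠ[𝓝 y] fun y => a * y :=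
    fun y hy => by
      filter_upwards [lt_mem_nhds hy] with s hs
      rw [max_eq_left hs.le, min_eq_right hs.le]; ring
  have hneg : ∀ y : ℝ, y < 0 → (fun y => a * max y 0 + b * min y 0) =ᶠ[𝓝 y] fun y => b * y :=
    fun y hy => by
      filter_upwards [gt_mem_nhds hy] with s hs
      rw [max_eq_right (le_of_lt hs), min_eq_left (le_of_lt hs)]; ring
  have hd : ∀ c y : ℝ, deriv (fun s => c * s) y = c := fun c y => by
    simp
  refine ⟨?_, fun y hy => ContDiffAt.contDiffWithinAt ?_, fun y hy => ?_, by simp⟩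
  · have h1 : LipschitzWith 1 fun y : ℝ => max y 0 := LipschitzWith.id.max_const 0
    have h2 : LipschitzWith 1 fun y : ℝ => min y 0 := LipschitzWith.id.min_const 0
    have h3 : ∀ c : ℝ, LipschitzWith ‖c‖₊ fun y : ℝ => c * y := fun c => lipschitzWith_smul c
    exact (((h3 a).comp h1).add ((h3 b).comp h2)).locallyLipschitz
  · rcases lt_or_gt_of_ne hy with h | h
    · exact (contDiffAt_const.mul contDiffAt_id).congr_of_eventuallyEq (hneg y h)
    · exact (contDiffAt_const.mul contDiffAt_id).congr_of_eventuallyEq (hpos y h)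
  · rcases lt_or_gt_of_ne hy with h | h
    · rw [(hneg y h).deriv_eq, hd]; exact hb
    · rw [(hpos y h).deriv_eq, hd]; exact ha

variable {d : ℕ}

lemma IsPlanarMetricSolution.isFrontLike {ε : ℝ} (hε : 0 < ε) {b : Pt d → Pt d}
    (hb : ∀ z, ε * ‖b z‖ ≤ 1 / 100) {ρ : Pt d → ℝ} (h : IsPlanarMetricSolution ε b ρ) :
    IsFrontLike ρ := by
  obtain ⟨K, hK⟩ := h.lipschitz
  let e : Pt d := WithLp.toLp 2 (0, 1)
  have hin : ∀ z : Pt d, ⟪e, z⟫ = z.snd := fun z => by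
    simp [e, WithLp.prod_inner_apply]
  have he : ‖e‖ = 1 := by simp [e]
  have hin' : ∀ z : Pt d, ⟪-e, z⟫ = -z.snd := fun z => by rw [inner_neg_left, hin]
  have hup : ∀ z : Pt d, |ρ z| ≤ K * |z.snd| := fun z => by
    have := abs_le_of_lipschitz_of_zero he hK (fun z hz => h.zero z (hin z ▸ hz)) z
    rwa [hin] at this
  have habove : ∀ z : Pt d, 0 < z.snd → z.snd / 2 ≤ ρ z := fun z hz => by
    have := half_mul_inner_le_of_supersolution (c := fun z => ε • b z) he
      (fun z => by rw [norm_smul, Real.norm_of_nonneg hε.le]; exact hb z) hK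
      (fun z hz => h.zero z (hin z ▸ hz))
      (fun z hz φ hφ hm => by
        rw [real_inner_smul_left]
        exact h.above.supersolution z (show 0 < z.snd from hin z ▸ hz) φ hφ hm)
      (fun δ hδ => (h.liminf_nonneg δ hδ).imp fun R hR z hz => hR z (hin z ▸ hz))
      (z₀ := z) (by rw [hin]; exact hz)
    rwa [hin] at this
  -- The same estimate for `-ρ`, with inner normal `-e` and drift `-b`.
  have hbelow : ∀ z : Pt d, z.snd < 0 → ρ z ≤ z.snd / 2 := fun z hz => by
    have := half_mul_inner_le_of_supersolution (c := fun z => ε • -b z) (e := -e)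
      (by rw [norm_neg, he])
      (fun z => by rw [norm_smul, norm_neg, Real.norm_of_nonneg hε.le]; exact hb z) hK.neg
      (fun z hz => by
        rw [hin', neg_eq_zero] at hz
        simp [h.zero z hz])
      (fun z hz φ hφ hm => by
        rw [hin'] at hz
        rw [real_inner_smul_left]
        exact h.below.supersolution z (show z.snd < 0 by linarith) φ hφ hm)
      (fun δ hδ => (h.limsup_nonpos δ hδ).imp fun R hR z hz => by
        rw [hin'] at hz
        have := hR z (by linarith)
        simpa using this)
      (z₀ := z) (by rw [hin']; linarith)
    rw [hin'] at this
    simp only [Pi.neg_apply] at this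
    linarith
  -- The steep slope is `K + 1` rather than `K`, since `K` may vanish and barriers need positive
  -- slopes.
  have hKp : (0 : ℝ) < K + 1 := by positivity
  refine ⟨fun C hC => ?_, _, _, isBarrier_piecewise (a := 1 / 2) (by norm_num) hKp,
    isBarrier_piecewise (b := 1 / 2) hKp (by norm_num), fun z => ?_⟩
  · obtain ⟨M, hM⟩ := hC.exists_bound_of_continuousOn hK.continuous.continuousOn
    exact memLp_top_of_bound hK.continuous.aestronglyMeasurable M
      (ae_restrict_of_forall_mem hC.measurableSet hM)
  · have h1 := abs_le.1 (hup z)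
    have hK0 : (0 : ℝ) ≤ K := K.2
    rcases lt_trichotomy z.snd 0 with hz | hz | hz
    · have h2 := hbelow z hz
      rw [abs_of_neg hz] at h1
      simp only [max_eq_right hz.le, min_eq_left hz.le]
      constructor <;> nlinarith
    · simp [h.zero z hz, hz]
    · have h2 := habove z hz
      rw [abs_of_pos hz] at h1
      simp only [max_eq_left hz.le, min_eq_right hz.le]
      constructor <;> nlinarith

end GEq

end

/-! ### Assembly of both claims. -/

theorem proposition2p2 {Ω : Type*} [MeasurableSpace Ω] (P : MeasureTheory.Measure Ω)
    [MeasureTheory.IsProbabilityMeasure P]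
    (n : ℕ) (hn : 2 ≤ n)
    (w : ℝ → Ω → ℝ) (hw : GEq.IsMildWhiteNoise P w)
    (uperp : GEq.Tr (n - 1) × ℝ × ℝ → GEq.Tr (n - 1))
    (huperp : ContDiffOn ℝ 2 uperp {q | 0 ≤ q.2.2})
    (upar : GEq.Tr (n - 1) × ℝ → ℝ)
    (hupar : ContDiffOn ℝ 2 upar {q | 0 ≤ q.2}) :
    ∀ᵐ ω ∂P, ∀ u : GEq.Pt (n - 1) → ℝ → GEq.Pt (n - 1),
      u = GEq.advection uperp upar (fun y => w y ω) →
      ∀ (ε : ℝ) (α : ENNReal), 0 < ε → 1 ≤ α →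
      (∀ z t, 0 ≤ t → ε * ‖u z t‖ ≤ 1 / 100) →
      -- the solution that starts from the planar metric profile is a perturbed traveling wave
      (∀ (ρ : GEq.Pt (n - 1) → ℝ) (χ : GEq.Tr (n - 1) × ℝ × ℝ → ℝ),
        GEq.IsPlanarMetricSolution ε (fun z => u z 0) ρ →
        GEq.SolvesGEquation ε α u ρ (GEq.ptw ε χ) →
        GEq.IsPerturbedTravelingWave ε α u χ) ∧
      -- the front of any solution with front-like datum is that of the perturbed traveling wave
      (∀ (χ : GEq.Tr (n - 1) × ℝ × ℝ → ℝ), GEq.IsPerturbedTravelingWave ε α u χ →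
        ∀ (G₀ : GEq.Pt (n - 1) → ℝ) (G : GEq.Pt (n - 1) × ℝ → ℝ),
        GEq.IsFrontLike G₀ → GEq.SolvesGEquation ε α u G₀ G →
        (∀ t, 0 < t → GEq.front t G = GEq.front t (GEq.ptw ε χ)) ∧
        GEq.subLevel G = GEq.subLevel (GEq.ptw ε χ)) := by
  obtain ⟨M, -, hM⟩ := hw.c1_bound
  filter_upwards [hM] with ω hω u hu ε α hε hα hbound
  refine ⟨fun ρ χ hρ hsol => ?_, fun χ hχ G₀ G hG₀ hG => ?_⟩
  · have heq : (fun z => GEq.ptw ε χ (z, 0)) = ρ := funext hsol.initial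
    refine ⟨by rw [heq]; exact hsol, ?_⟩
    rw [heq]
    exact hρ.isFrontLike hε fun z => hbound z 0 le_rfl
  · have hvb : ∀ q : GEq.Pt (n - 1) × ℝ, 0 ≤ q.2 → ‖GEq.drift ε α u q‖ ≤ 1 := fun q hq => by
      rw [GEq.drift, norm_smul, Real.norm_of_nonneg hε.le]
      exact (hbound q.1 _ (mul_nonneg (GEq.epsPow_nonneg hε α) hq)).trans (by norm_num)
    have hvL : ∀ C : Set (GEq.Pt (n - 1) × ℝ), C ⊆ {q | 0 ≤ q.2} → IsCompact C →
        ∃ L, LipschitzOnWith L (GEq.drift ε α u) C := fun C hCS hC => by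
      rw [hu]
      exact GEq.drift_lipschitzOn hε α (huperp.of_le one_le_two) (hupar.of_le one_le_two) hω.1
        hCS hC
    have h1 := fun p hp => GEq.sign_imp_of_frontLike hvb hvL hG₀ hχ.frontLike hG hχ.solves
      (p := p) hp
    have h2 := fun p hp => GEq.sign_imp_of_frontLike hvb hvL hχ.frontLike hG₀ hχ.solves hG
      (p := p) hp
    refine ⟨fun t ht => ?_, ?_⟩
    · ext z
      have h1z := h1 (z, t) ht.le
      have h2z := h2 (z, t) ht.le
      simp only [GEq.front, Set.mem_ofPred_eq]
      exact ⟨fun h => le_antisymm (h2z.1 h.le) (h1z.2 h.ge),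
        fun h => le_antisymm (h1z.1 h.le) (h2z.2 h.ge)⟩
    · ext p
      simp only [GEq.subLevel, Set.mem_ofPred_eq]
      exact and_congr_right fun hp => ⟨(h2 p hp).1, (h1 p hp).1⟩
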